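/- Let $p>1$, $a>0$, $b\ge 0$ and $c\ge 0$ be real numbers, and let $$\widetilde{\mathcal L}_{abc}=-\partial_y^2+\tfrac14a^2y^2-\tfrac a2+\tfrac{2a}{p-1}-\frac{2pc}{p-1+by^2}$$ be regarded as an unbounded operator in the complex Hilbert space $L^2(\mathbb R)$ on its maximal domain, i.e. the set of all $u\in L^2(\mathbb R)$ for which the distribution $\widetilde{\mathcal L}_{abc}u$ belongs to $L^2(\mathbb R)$. Then all eigenvalues of $\widetilde{\mathcal L}_{abc}$ are real; listed in nondecreasing order and repeated according to multiplicity they form an infinite sequence $\lambda_0\le\lambda_1\le\lambda_2\le\cdots$; and for every $n=0,1,2,\dots$ $$na+\frac{2}{p-1}(a-pc)\;\le\;\lambda_n\;\le\;na+\frac{2a}{p-1}.$$ -/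

import Mathlib

open MeasureTheory
open scoped ContDiff

noncomputable section

/-- The complex Hilbert space `L²(ℝ)` with respect to Lebesgue measure. -/
abbrev L2R : Type := Lp ℂ 2 (volume : Measure ℝ)

/-- `WeakEq V u f`: the equation `-u'' + V u = f` holds in the sense of distributions on `ℝ`, i.e.
`V u` is locally integrable and `∫ (-φ'' + V φ) u = ∫ φ f` for every smooth compactly supported
real test function `φ`. -/
def WeakEq (V : ℝ → ℝ) (u f : L2R) : Prop :=
  LocallyIntegrable (fun y : ℝ => (V y : ℂ) * u y) ∧
    ∀ φ : ℝ → ℝ, ContDiff ℝ ∞ φ → HasCompactSupport φ →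
      -(∫ y, ((deriv (deriv φ) y : ℝ) : ℂ) * u y) + ∫ y, (φ y : ℂ) * ((V y : ℂ) * u y)
        = ∫ y, (φ y : ℂ) * f y

lemma L2R.locallyIntegrable (u : L2R) : LocallyIntegrable (fun y : ℝ => u y) :=
  (Lp.memLp u).locallyIntegrable (by norm_num)

lemma integrable_test_mul {φ : ℝ → ℝ} (hφ : Continuous φ) (hc : HasCompactSupport φ)
    {g : ℝ → ℂ} (hg : LocallyIntegrable g) : Integrable (fun y => (φ y : ℂ) * g y) := by
  simpa [Complex.real_smul] using hg.integrable_smul_left_of_hasCompactSupport hφ hc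

lemma continuous_deriv_deriv {φ : ℝ → ℝ} (hφ : ContDiff ℝ ∞ φ) :
    Continuous (deriv (deriv φ)) := by
  have h := hφ.continuous_iteratedDeriv 2 (WithTop.coe_le_coe.2 (le_top : (2 : ℕ∞) ≤ ⊤))
  simpa [iteratedDeriv_succ, iteratedDeriv_zero] using h

/-- The graph `{(u, f) ∈ L² × L² | -u'' + V u = f weakly}`. -/
def schrodingerGraph (V : ℝ → ℝ) : Submodule ℂ (L2R × L2R) where
  carrier := {x | WeakEq V x.1 x.2}
  zero_mem' := by
    have h0 : ((0 : L2R) : ℝ → ℂ) =ᵐ[volume] 0 := Lp.coeFn_zero ℂ 2 volume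
    have hm : ∀ g : ℝ → ℂ, (fun y => g y * (0 : L2R) y) =ᵐ[volume] 0 := fun g => by
      filter_upwards [h0] with y hy
      simp only [hy, Pi.zero_apply, mul_zero]
    refine ⟨(locallyIntegrable_zero (μ := volume)).congr (hm _).symm, fun φ _ _ => ?_⟩
    have e1 : ∫ y, (φ y : ℂ) * ((V y : ℂ) * (0 : L2R) y) = 0 := by
      refine integral_eq_zero_of_ae ?_
      filter_upwards [h0] with y hy
      simp only [hy, Pi.zero_apply, mul_zero]
    have e2 : ∀ g : ℝ → ℂ, ∫ y, g y * (0 : L2R) y = 0 := fun g => integral_eq_zero_of_ae (hm g)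
    simp only [Prod.fst_zero, Prod.snd_zero]
    rw [e1, e2, e2]
    simp
  add_mem' := by
    rintro ⟨u, f⟩ ⟨v, g⟩ ⟨hu, hu'⟩ ⟨hv, hv'⟩
    simp only at hu hu' hv hv'
    have huv := Lp.coeFn_add u v
    have hfg := Lp.coeFn_add f g
    have hV : (fun y => (V y : ℂ) * u y) + (fun y => (V y : ℂ) * v y)
        =ᵐ[volume] fun y => (V y : ℂ) * (u + v : L2R) y := by
      filter_upwards [huv] with y hy
      simp only [hy, Pi.add_apply]
      ring
    refine ⟨(hu.add hv).congr hV, fun φ hφ hc => ?_⟩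
    have hφ2 := continuous_deriv_deriv hφ
    have hc2 : HasCompactSupport (deriv (deriv φ)) := hc.deriv.deriv
    have e1 : ∫ y, ((deriv (deriv φ) y : ℝ) : ℂ) * (u + v : L2R) y
        = (∫ y, ((deriv (deriv φ) y : ℝ) : ℂ) * u y)
          + ∫ y, ((deriv (deriv φ) y : ℝ) : ℂ) * v y := by
      rw [← integral_add (integrable_test_mul hφ2 hc2 u.locallyIntegrable)
        (integrable_test_mul hφ2 hc2 v.locallyIntegrable)]
      refine integral_congr_ae ?_
      filter_upwards [huv] with y hy
      simp only [hy, Pi.add_apply]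
      ring
    have e2 : ∫ y, (φ y : ℂ) * ((V y : ℂ) * (u + v : L2R) y)
        = (∫ y, (φ y : ℂ) * ((V y : ℂ) * u y)) + ∫ y, (φ y : ℂ) * ((V y : ℂ) * v y) := by
      rw [← integral_add (integrable_test_mul hφ.continuous hc hu)
        (integrable_test_mul hφ.continuous hc hv)]
      refine integral_congr_ae ?_
      filter_upwards [huv] with y hy
      simp only [hy, Pi.add_apply]
      ring
    have e3 : ∫ y, (φ y : ℂ) * (f + g : L2R) y
        = (∫ y, (φ y : ℂ) * f y) + ∫ y, (φ y : ℂ) * g y := by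
      rw [← integral_add (integrable_test_mul hφ.continuous hc f.locallyIntegrable)
        (integrable_test_mul hφ.continuous hc g.locallyIntegrable)]
      refine integral_congr_ae ?_
      filter_upwards [hfg] with y hy
      simp only [hy, Pi.add_apply]
      ring
    simp only [Prod.mk_add_mk]
    rw [e1, e2, e3, ← hu' φ hφ hc, ← hv' φ hφ hc]
    ring
  smul_mem' := by
    rintro z ⟨u, f⟩ ⟨hu, hu'⟩
    simp only at hu hu'
    have hzu := Lp.coeFn_smul z u
    have hzf := Lp.coeFn_smul z f
    have hV : (z • fun y => (V y : ℂ) * u y)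
        =ᵐ[volume] fun y => (V y : ℂ) * (z • u : L2R) y := by
      filter_upwards [hzu] with y hy
      simp [hy]
      ring
    refine ⟨(hu.smul z).congr hV, fun φ hφ hc => ?_⟩
    have e0 : ∀ (g : ℝ → ℂ) (w : L2R), ∫ y, g y * (z • w : L2R) y = z * ∫ y, g y * w y := by
      intro g w
      rw [← integral_const_mul]
      refine integral_congr_ae ?_
      filter_upwards [Lp.coeFn_smul z w] with y hy
      simp [hy]
      ring
    have e2 : ∫ y, (φ y : ℂ) * ((V y : ℂ) * (z • u : L2R) y)
        = z * ∫ y, (φ y : ℂ) * ((V y : ℂ) * u y) := by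
      simpa [mul_assoc] using e0 (fun y => (φ y : ℂ) * (V y : ℂ)) u
    simp only [Prod.smul_mk]
    rw [e0, e2, e0, ← hu' φ hφ hc]
    ring

/-- The distribution `-u'' + V u` is determined by `u`. -/
lemma schrodingerGraph_functional (V : ℝ → ℝ) :
    ∀ x : L2R × L2R, x ∈ schrodingerGraph V → x.1 = 0 → x.2 = 0 := by
  rintro ⟨u, f⟩ ⟨-, h⟩ h0
  simp only at h h0
  subst h0
  have hz : ((0 : L2R) : ℝ → ℂ) =ᵐ[volume] 0 := Lp.coeFn_zero ℂ 2 volume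
  have key : ∀ᵐ y : ℝ, f y = 0 := by
    refine ae_eq_zero_of_integral_contDiff_smul_eq_zero f.locallyIntegrable fun φ hφ hc => ?_
    simp only [Complex.real_smul]
    rw [← h φ hφ hc]
    have e1 : ∫ y, ((deriv (deriv φ) y : ℝ) : ℂ) * (0 : L2R) y = 0 := by
      refine integral_eq_zero_of_ae ?_
      filter_upwards [hz] with y hy
      simp only [hy, Pi.zero_apply, mul_zero]
    have e2 : ∫ y, (φ y : ℂ) * ((V y : ℂ) * (0 : L2R) y) = 0 := by
      refine integral_eq_zero_of_ae ?_
      filter_upwards [hz] with y hy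
      simp only [hy, Pi.zero_apply, mul_zero]
    rw [e1, e2]
    simp
  exact (Lp.eq_zero_iff_ae_eq_zero).2 key

/-- The Schrödinger operator `-∂² + V` in `L²(ℝ)` as an unbounded operator on its maximal domain
`{u ∈ L² | V u ∈ L¹_loc, -u'' + V u ∈ L²}`, derivatives being distributional. -/
def schrodingerOp (V : ℝ → ℝ) : L2R →ₗ.[ℂ] L2R :=
  (schrodingerGraph V).toLinearPMap

/-- `u` is in the domain with `(-∂² + V) u = f` exactly if `-u'' + V u = f` weakly. -/
lemma mem_graph_schrodingerOp (V : ℝ → ℝ) (u f : L2R) :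
    (u, f) ∈ (schrodingerOp V).graph ↔ WeakEq V u f := by
  rw [schrodingerOp, Submodule.toLinearPMap_graph_eq _ (schrodingerGraph_functional V)]
  rfl

/-- The eigenspace `{u ∈ dom A | A u = μ u}` of an unbounded operator `A`. -/
def LinearPMap.eigenspace {E : Type*} [AddCommGroup E] [Module ℂ E] (A : E →ₗ.[ℂ] E) (μ : ℂ) :
    Submodule ℂ E where
  carrier := {u | ∃ h : u ∈ A.domain, A ⟨u, h⟩ = μ • u}
  zero_mem' := ⟨A.domain.zero_mem, by rw [smul_zero]; exact A.map_zero⟩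
  add_mem' := by
    rintro u v ⟨hu, hu'⟩ ⟨hv, hv'⟩
    refine ⟨A.domain.add_mem hu hv, ?_⟩
    rw [smul_add, ← hu', ← hv', ← A.map_add]
    rfl
  smul_mem' := by
    rintro z u ⟨hu, hu'⟩
    refine ⟨A.domain.smul_mem z hu, ?_⟩
    rw [smul_comm, ← hu', ← A.map_smul]
    rfl

/-- `lam 0 ≤ lam 1 ≤ lam 2 ≤ …` is the list of all eigenvalues of `A`, each one repeated according
to its multiplicity: every `μ : ℂ` occurs in the list exactly `dim ker (A - μ)` times (so `μ` does
not occur if it is not an eigenvalue; in particular all eigenvalues are real). -/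
def IsEigenvalueSequence (A : L2R →ₗ.[ℂ] L2R) (lam : ℕ → ℝ) : Prop :=
  Monotone lam ∧
    ∀ μ : ℂ, Module.rank ℂ (A.eigenspace μ) = Cardinal.mk {n : ℕ // (lam n : ℂ) = μ}

/-- The potential `a² y² / 4 - a / 2 + 2 a / (p - 1) - 2 p c / (p - 1 + b y²)`. -/
def potentialABC (p a b c : ℝ) (y : ℝ) : ℝ :=
  1 / 4 * a ^ 2 * y ^ 2 - a / 2 + 2 * a / (p - 1) - 2 * p * c / (p - 1 + b * y ^ 2)

/-- The operator `-∂² + a² y² / 4 - a / 2 + 2 a / (p - 1) - 2 p c / (p - 1 + b y²)` in `L²(ℝ)`. -/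
def linearizedOp (p a b c : ℝ) : L2R →ₗ.[ℂ] L2R :=
  schrodingerOp (potentialABC p a b c)

end

/-! The operator is `H + q`, where `H = -∂² + a² y² / 4 - a / 2` has the simple eigenvalues `n a`
and `q` is bounded. Since the denominator `p - 1 + b y²` is at least `p - 1`, the values of `q` lie
between `2 (a - p c) / (p - 1)` and `2 a / (p - 1)`. By the min-max principle, adding `q` moves the
`n`-th eigenvalue by an amount between these two bounds.

Quadratic form domains are avoided by working with coefficients. In the Hermite basis the weak
equation for `H` on its maximal domain becomes `DiagRel`, an identity between coefficients
(`weakEq_oscPotential_iff`). One direction tests the weak equation with Hermite functions, by means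
of cutoffs; the other is Parseval's identity. Completeness of the basis follows from the moments and
the Fourier transform (`eq_zero_of_integral_gaussPoly`).

For a bounded symmetric `Q` and a large shift `k`, the inverse of `H + Q + k` is compact, symmetric
and injective, so its eigenvectors form a Hilbert basis (`exists_hilbertBasis_diagRel`). Min-max is
then a dimension count between two bases (`DiagRel.le_of_card_lt`), used once in each direction in
`eigenvalueSequence_of_perturbation`. -/

/-! ### Listing a discrete family in nondecreasing order. -/

/-- An infinite family of reals with finite sublevel sets can be listed in nondecreasing order. -/
lemma exists_equiv_nat_monotone {ι : Type*} [Infinite ι] (f : ι → ℝ)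
    (hf : ∀ c, {i | f i ≤ c}.Finite) : ∃ σ : ℕ ≃ ι, Monotone (f ∘ σ) := by
  have hcount : Countable ι := by
    rw [← Set.countable_univ_iff]
    have : (Set.univ : Set ι) = ⋃ n : ℕ, {i | f i ≤ n} := by
      ext i
      obtain ⟨n, hn⟩ := exists_nat_ge (f i)
      simp only [Set.mem_univ, Set.mem_iUnion, true_iff]
      exact ⟨n, hn⟩
    rw [this]
    exact Set.countable_iUnion fun n => (hf n).countable
  obtain ⟨enc, henc⟩ := hcount.exists_injective_nat
  -- The injection `enc` breaks ties between equal values, so that `g` is injective into a linear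
  -- order and counting predecessors separates indices.
  let g : ι → ℝ ×ₗ ℕ := fun i => toLex (f i, enc i)
  have hg : Function.Injective g := fun i j hij => henc (Prod.ext_iff.1 (toLex.injective hij)).2
  have hgf : ∀ i j, g i ≤ g j → f i ≤ f j := fun i j hij => by
    rcases Prod.Lex.le_iff.1 hij with h | h
    · exact h.le
    · exact h.1.le
  have hfin : ∀ i, {j | g j < g i}.Finite := fun i =>
    (hf (f i)).subset fun j hj => hgf j i (le_of_lt hj)
  let r : ι → ℕ := fun i => {j | g j < g i}.ncard
  have hr : ∀ i j, g i < g j → r i < r j := fun i j hij => by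
    refine Set.ncard_lt_ncard ?_ (hfin j)
    refine ⟨fun k hk => lt_trans hk hij, fun hss => ?_⟩
    exact lt_irrefl (g i) (hss (show i ∈ {k | g k < g j} from hij))
  have hrinj : Function.Injective r := fun i j hij => by
    rcases lt_trichotomy (g i) (g j) with h | h | h
    · exact absurd hij (hr _ _ h).ne
    · exact hg h
    · exact absurd hij (hr _ _ h).ne'
  have : Infinite (Set.range r) := Set.infinite_range_of_injective hrinj |>.to_subtype
  classical
  -- The ranks need not be shown to exhaust `ℕ`: any infinite subset of `ℕ` is order isomorphic to
  -- `ℕ`.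
  let σ : ℕ ≃ ι := (Nat.Subtype.orderIsoOfNat (Set.range r)).toEquiv.trans
    (Equiv.ofInjective r hrinj).symm
  refine ⟨σ, fun n m hnm => ?_⟩
  have hσ : ∀ n, r (σ n) = (Nat.Subtype.orderIsoOfNat (Set.range r) n : ℕ) := fun n =>
    Equiv.apply_ofInjective_symm hrinj _
  have h1 : r (σ n) ≤ r (σ m) := by
    rw [hσ, hσ]
    exact (Nat.Subtype.orderIsoOfNat (Set.range r)).monotone hnm
  refine hgf _ _ (le_of_not_gt fun hlt => ?_)
  exact absurd h1 (not_le.2 (hr _ _ hlt))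

/-! ### Diagonal operators and the min-max comparison. -/

section Abstract

variable {E : Type*} [NormedAddCommGroup E] [InnerProductSpace ℂ E]

local notation "⟪" x ", " y "⟫" => inner ℂ x y

/-- `f = D u`, where `D` is the diagonal operator on its maximal domain with entries `d` in the
Hilbert basis `h`. -/
def DiagRel {ι : Type*} (h : HilbertBasis ι ℂ E) (d : ι → ℝ) (u f : E) : Prop :=
  ∀ n, ⟪h n, f⟫ = d n * ⟪h n, u⟫

lemma DiagRel.sum_smul {ι κ : Type*} {h : HilbertBasis ι ℂ E} {d : ι → ℝ} {v w : κ → E}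
    (hvw : ∀ i, DiagRel h d (v i) (w i)) (J : Finset κ) (c : J → ℂ) :
    DiagRel h d (∑ i, c i • v i) (∑ i, c i • w i) := fun n => by
  simp only [inner_sum, inner_smul_right, hvw _ n, Finset.mul_sum]
  exact Finset.sum_congr rfl fun i _ => by ring

/-- Parseval's identity together with the reality of the entries. This is the symmetry of the
diagonal operator, without reference to its domain. -/
lemma DiagRel.inner_comm {ι : Type*} {h : HilbertBasis ι ℂ E} {d : ι → ℝ} {u f v g : E}
    (hu : DiagRel h d u f) (hv : DiagRel h d v g) : ⟪u, g⟫ = ⟪f, v⟫ := by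
  rw [← h.tsum_inner_mul_inner u g, ← h.tsum_inner_mul_inner f v]
  refine tsum_congr fun n => ?_
  rw [hv n, ← inner_conj_symm f, hu n, ← inner_conj_symm u]
  simp only [map_mul, Complex.conj_ofReal]
  ring

lemma HilbertBasis.hasSum_norm_sq_inner {ι : Type*} (h : HilbertBasis ι ℂ E) (u : E) :
    HasSum (fun n => ‖⟪h n, u⟫‖ ^ 2) (‖u‖ ^ 2) := by
  have := Complex.hasSum_re (h.hasSum_inner_mul_inner u u)
  convert this using 1
  · ext n
    rw [← inner_conj_symm u, ← Complex.normSq_eq_conj_mul_self, Complex.ofReal_re,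
      Complex.normSq_eq_norm_sq]
  · exact (inner_self_eq_norm_sq (𝕜 := ℂ) u).symm

/-- Only the entries on the support of `u` matter, so a vector orthogonal to finitely many basis
vectors sees only the remaining entries. -/
lemma DiagRel.le_re_inner {ι : Type*} {h : HilbertBasis ι ℂ E} {d : ι → ℝ} {u f : E}
    (hu : DiagRel h d u f) {D : ℝ} (hD : ∀ n, ⟪h n, u⟫ ≠ 0 → D ≤ d n) :
    D * ‖u‖ ^ 2 ≤ (⟪u, f⟫).re := by
  refine hasSum_le (fun n => ?_) ((h.hasSum_norm_sq_inner u).mul_left D)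
    (Complex.hasSum_re (h.hasSum_inner_mul_inner u f))
  have : ⟪u, h n⟫ * ⟪h n, f⟫ = ((d n * ‖⟪h n, u⟫‖ ^ 2 : ℝ) : ℂ) := by
    rw [hu n, ← inner_conj_symm u, mul_left_comm, ← Complex.normSq_eq_conj_mul_self,
      Complex.normSq_eq_norm_sq]
    push_cast
    rfl
  rw [this, Complex.ofReal_re]
  by_cases h0 : ⟪h n, u⟫ = 0
  · simp [h0]
  · exact mul_le_mul_of_nonneg_right (hD n h0) (by positivity)

/-- Dimension count behind the min-max principle. -/
lemma DiagRel.le_of_card_lt {ι κ : Type*} {h : HilbertBasis ι ℂ E} {d : ι → ℝ} {v w : κ → E}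
    (hv : Orthonormal ℂ v) (hvw : ∀ i, DiagRel h d (v i) (w i)) {J : Finset κ} {F : Finset ι}
    (hcard : F.card < J.card) {D L : ℝ} (hD : ∀ n ∉ F, D ≤ d n)
    (hL : ∀ c : J → ℂ, (⟪∑ i, c i • v i, ∑ i, c i • w i⟫).re ≤ L * ‖∑ i, c i • v i‖ ^ 2) :
    D ≤ L := by
  let φ : (J → ℂ) →ₗ[ℂ] (F → ℂ) :=
    { toFun := fun c n => ⟪h n, ∑ i, c i • v i⟫
      map_add' := fun c c' => by
        ext n
        simp [add_smul, Finset.sum_add_distrib]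
      map_smul' := fun z c => by
        ext n
        simp [mul_smul, ← Finset.smul_sum] }
  -- The span of the `v i` with `i ∈ J` has larger dimension than the number of conditions indexed
  -- by `F`, hence contains a nonzero vector orthogonal to every `h n` with `n ∈ F`.
  have hker : LinearMap.ker φ ≠ ⊥ := LinearMap.ker_ne_bot_of_finrank_lt (by simpa using hcard)
  obtain ⟨c, hc, hc0⟩ := Submodule.exists_mem_ne_zero_of_ne_bot hker
  have hu0 : ∑ i, c i • v i ≠ 0 := fun h0 => hc0 <| by
    have hli := (hv.comp (fun i : J => (i : κ)) Subtype.val_injective).linearIndependent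
    exact funext (Fintype.linearIndependent_iff.1 hli c h0)
  have h1 := (DiagRel.sum_smul hvw J c).le_re_inner (D := D) fun n hn => hD n fun hnF =>
    hn (congrFun (LinearMap.mem_ker.1 hc) ⟨n, hnF⟩)
  have hpos : 0 < ‖∑ i, c i • v i‖ ^ 2 := by positivity
  exact le_of_mul_le_mul_right (h1.trans (hL c)) hpos

/-- If the entries of a diagonal operator are at most `L` on `J`, so is its quadratic form on
the span of the corresponding basis vectors. -/
lemma Orthonormal.re_inner_sum_le {κ : Type*} {v : κ → E} (hv : Orthonormal ℂ v) {J : Finset κ}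
    {l : κ → ℝ} {L : ℝ} (hL : ∀ i ∈ J, l i ≤ L) (c : J → ℂ) :
    (⟪∑ i, c i • v i, ∑ i, c i • ((l i : ℂ) • v i)⟫).re ≤ L * ‖∑ i, c i • v i‖ ^ 2 := by
  have hv' := hv.comp (fun i : J => (i : κ)) Subtype.val_injective
  have h1 : ∀ c' : J → ℂ, ⟪∑ i, c i • v i, ∑ i, c' i • v i⟫
      = ∑ i, (starRingEnd ℂ) (c i) * c' i := fun c' => hv'.inner_sum c c' Finset.univ
  have h2 : ‖∑ i, c i • v i‖ ^ 2 = ∑ i, ‖c i‖ ^ 2 := by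
    have := congrArg Complex.re (h1 c)
    rw [← RCLike.re_eq_complex_re, inner_self_eq_norm_sq (𝕜 := ℂ)] at this
    rw [this, RCLike.re_eq_complex_re, Complex.re_sum]
    refine Finset.sum_congr rfl fun i _ => ?_
    rw [← Complex.normSq_eq_conj_mul_self, Complex.ofReal_re, Complex.normSq_eq_norm_sq]
  simp only [smul_smul]
  rw [h1, h2, Finset.mul_sum, Complex.re_sum]
  refine Finset.sum_le_sum fun i _ => ?_
  rw [← mul_assoc, ← Complex.normSq_eq_conj_mul_self, Complex.normSq_eq_norm_sq,
    ← Complex.ofReal_mul, Complex.ofReal_re, mul_comm]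
  exact mul_le_mul_of_nonneg_right (hL i i.2) (by positivity)

section Perturbation

variable {ι κ : Type*} {h : HilbertBasis ι ℂ E} {d : ι → ℝ} {Q : E →L[ℂ] E}
  {e : HilbertBasis κ ℂ E} {l : κ → ℝ}

/-- On the span of the `e i` with `i ∈ J`, the form of the perturbed operator is at most `L`, so
that of the diagonal operator is at most `L - m`. -/
lemma le_eigenvalue_of_card_lt (he : ∀ i, DiagRel h d (e i) ((l i : ℂ) • e i - Q (e i)))
    {m : ℝ} (hm : ∀ u, m * ‖u‖ ^ 2 ≤ (⟪u, Q u⟫).re) {J : Finset κ} {F : Finset ι}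
    (hcard : F.card < J.card) {D L : ℝ} (hD : ∀ n ∉ F, D ≤ d n) (hL : ∀ i ∈ J, l i ≤ L) :
    D + m ≤ L := by
  suffices D ≤ L - m by linarith
  refine DiagRel.le_of_card_lt e.orthonormal he hcard hD fun c => ?_
  have hs : ∑ i : J, c i • ((l i : ℂ) • e i - Q (e i))
      = ∑ i : J, c i • ((l i : ℂ) • e i) - Q (∑ i : J, c i • e i) := by
    simp [smul_sub, Finset.sum_sub_distrib, map_sum]
  rw [hs, inner_sub_right, Complex.sub_re, sub_mul]
  exact sub_le_sub (e.orthonormal.re_inner_sum_le hL c) (hm _)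

/-- The same count with the two bases exchanged: the unperturbed operator plus `Q` is diagonal in
`e`, and the trial space is spanned by vectors of `h`. -/
lemma eigenvalue_le_of_card_lt (hQ : ∀ u v, ⟪Q u, v⟫ = ⟪u, Q v⟫)
    (he : ∀ i, DiagRel h d (e i) ((l i : ℂ) • e i - Q (e i)))
    {M : ℝ} (hM : ∀ u, (⟪u, Q u⟫).re ≤ M * ‖u‖ ^ 2) {J : Finset ι} {F : Finset κ}
    (hcard : F.card < J.card) {D L : ℝ} (hD : ∀ n ∈ J, d n ≤ D) (hL : ∀ i ∉ F, L ≤ l i) :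
    L ≤ D + M := by
  -- Conjugating `he` swaps the roles of the two bases; the symmetry of `Q` moves it onto `h n`.
  have hh : ∀ n, DiagRel e l (h n) ((d n : ℂ) • h n + Q (h n)) := fun n i => by
    have := congrArg (starRingEnd ℂ) (he i n)
    simp only [map_mul, inner_conj_symm, inner_sub_left, inner_smul_left,
      Complex.conj_ofReal, hQ] at this
    rw [inner_add_right, inner_smul_right, ← this]
    ring
  refine DiagRel.le_of_card_lt h.orthonormal hh hcard hL fun c => ?_
  have hs : ∑ i : J, c i • ((d i : ℂ) • h i + Q (h i))
      = ∑ i : J, c i • ((d i : ℂ) • h i) + Q (∑ i : J, c i • h i) := by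
    simp [Finset.sum_add_distrib, map_sum]
  rw [hs, inner_add_right, Complex.add_re, add_mul]
  exact add_le_add (h.orthonormal.re_inner_sum_le hD c) (hM _)

end Perturbation

end Abstract

/-! ### Compact resolvents and eigenbases of perturbed diagonal operators. -/

section Abstract

variable {E : Type*} [NormedAddCommGroup E] [InnerProductSpace ℂ E]

local notation "⟪" x ", " y "⟫" => inner ℂ x y

lemma HilbertBasis.ext_inner {ι : Type*} (h : HilbertBasis ι ℂ E) {u v : E}
    (huv : ∀ n, ⟪h n, u⟫ = ⟪h n, v⟫) : u = v := by
  apply h.repr.injective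
  ext n
  rw [h.repr_apply_apply, h.repr_apply_apply, huv n]

/-- The bounded operator that is diagonal with entries `t` in the Hilbert basis `h`. -/
noncomputable def HilbertBasis.diagonal {ι : Type*} (h : HilbertBasis ι ℂ E) (t : ι → ℝ) {K : ℝ}
    (hK : 0 ≤ K) (ht : ∀ n, |t n| ≤ K) : E →L[ℂ] E :=
  (h.repr.symm.toContinuousLinearEquiv : lp (fun _ : ι => ℂ) 2 →L[ℂ] E) ∘L
    (lp.mapCLM 2 (fun n => (t n : ℂ) • ContinuousLinearMap.id ℂ ℂ) hK
      (fun n => by simpa [norm_smul] using ht n)) ∘L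
    (h.repr.toContinuousLinearEquiv : E →L[ℂ] lp (fun _ : ι => ℂ) 2)

lemma HilbertBasis.inner_diagonal {ι : Type*} (h : HilbertBasis ι ℂ E) (t : ι → ℝ) {K : ℝ}
    (hK : 0 ≤ K) (ht : ∀ n, |t n| ≤ K) (n : ι) (u : E) :
    ⟪h n, h.diagonal t hK ht u⟫ = t n * ⟪h n, u⟫ := by
  rw [← h.repr_apply_apply, ← h.repr_apply_apply]
  simp [HilbertBasis.diagonal]

lemma HilbertBasis.norm_diagonal_le {ι : Type*} (h : HilbertBasis ι ℂ E) (t : ι → ℝ) {K : ℝ}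
    (hK : 0 ≤ K) (ht : ∀ n, |t n| ≤ K) : ‖h.diagonal t hK ht‖ ≤ K := by
  refine ContinuousLinearMap.opNorm_le_bound _ hK fun u => ?_
  have := (lp.mapCLM (E := fun _ : ι => ℂ) (F := fun _ : ι => ℂ) 2
    (fun n => (t n : ℂ) • ContinuousLinearMap.id ℂ ℂ) hK
      (fun n => by simpa [norm_smul] using ht n)).le_of_opNorm_le
      (lp.norm_mapCLM_le 2 _ hK _) (h.repr u)
  simpa [HilbertBasis.diagonal] using this

/-- A diagonal operator whose entries tend to zero is compact. -/
lemma HilbertBasis.isCompactOperator_diagonal [CompleteSpace E] {ι : Type*}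
    (h : HilbertBasis ι ℂ E) (t : ι → ℝ) {K : ℝ} (hK : 0 ≤ K) (ht : ∀ n, |t n| ≤ K)
    (h0 : Filter.Tendsto t Filter.cofinite (nhds 0)) :
    IsCompactOperator (h.diagonal t hK ht) := by
  have hfr : ∀ s : Finset ι, IsCompactOperator
      (∑ n ∈ s, (t n : ℂ) • (innerSL ℂ (h n)).smulRight (h n) : E →L[ℂ] E) := fun s => by
    classical
    induction s using Finset.induction_on with
    | empty => simpa using! isCompactOperator_zero
    | insert n s hn ih =>
      rw [Finset.sum_insert hn]
      refine IsCompactOperator.add (IsCompactOperator.smul ?_ _) ih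
      have : IsCompactOperator (innerSL ℂ (h n)) :=
        isCompactOperator_of_locallyCompactSpace_dom (innerSL ℂ (h n))
      exact this.clm_comp ((ContinuousLinearMap.id ℂ ℂ).smulRight (h n))
  refine isCompactOperator_of_tendsto (l := Filter.atTop) (F := fun s : Finset ι =>
    (∑ n ∈ s, (t n : ℂ) • (innerSL ℂ (h n)).smulRight (h n) : E →L[ℂ] E)) ?_
    (Filter.Eventually.of_forall hfr)
  refine Metric.tendsto_nhds.2 fun ε hε => ?_
  have hfin := (h0.eventually (Metric.ball_mem_nhds 0 (half_pos hε)))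
  rw [Filter.eventually_cofinite] at hfin
  classical
  filter_upwards [Filter.eventually_ge_atTop hfin.toFinset] with s hs
  -- The diagonal operator minus its truncation to `s` is diagonal again, with the small tail of `t`
  -- as entries.
  let t' : ι → ℝ := fun n => if n ∈ s then 0 else t n
  have ht' : ∀ n, |t' n| ≤ ε / 2 := fun n => by
    by_cases hn : n ∈ s
    · simp only [t', hn, if_true, abs_zero]
      positivity
    · simp only [t', hn, if_false]
      have : n ∉ hfin.toFinset := fun hn' => hn (hs hn')
      simp only [Set.Finite.mem_toFinset, Set.mem_ofPred_eq, not_not,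
        dist_zero_right, Real.norm_eq_abs] at this
      exact this.le
  have hdiff : h.diagonal t hK ht - (∑ n ∈ s, (t n : ℂ) • (innerSL ℂ (h n)).smulRight (h n))
      = h.diagonal t' (half_pos hε).le ht' := by
    ext u
    refine h.ext_inner fun k => ?_
    have horth := orthonormal_iff_ite.1 h.orthonormal
    rw [sub_apply, inner_sub_right, h.inner_diagonal, h.inner_diagonal]
    simp only [sum_apply, smul_apply,
      ContinuousLinearMap.smulRight_apply, innerSL_apply_apply, inner_sum, inner_smul_right,
      horth, mul_ite, mul_one, mul_zero, Finset.sum_ite_eq, t']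
    split_ifs <;> simp
  rw [dist_comm, dist_eq_norm, hdiff]
  exact (h.norm_diagonal_le _ _ _).trans_lt (half_lt_self hε)

/-- Eigenvectors of a compact symmetric operator form a Hilbert basis. -/
lemma IsCompactOperator.exists_hilbertBasis_eigenvectors [CompleteSpace E] {S : E →L[ℂ] E}
    (hS : IsCompactOperator S) (hsymm : (S : E →ₗ[ℂ] E).IsSymmetric)
    (hinj : Function.Injective S) :
    ∃ (κ : Type) (e : HilbertBasis κ ℂ E) (s : κ → ℝ), ∀ i, s i ≠ 0 ∧ S (e i) = (s i : ℂ) • e i := by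
  -- Compactness bounds the dimension only for nonzero eigenvalues; the kernel is trivial by
  -- injectivity.
  have hfin : ∀ μ : ℂ, FiniteDimensional ℂ (Module.End.eigenspace (S : E →ₗ[ℂ] E) μ) := fun μ => by
    by_cases hμ : μ = 0
    · have : Module.End.eigenspace (S : E →ₗ[ℂ] E) μ = ⊥ := by
        rw [hμ, Module.End.eigenspace_zero]
        exact LinearMap.ker_eq_bot.2 hinj
      rw [this]
      infer_instance
    · exact S.finite_dimensional_eigenspace hS μ hμ
  let v : ∀ μ : ℂ, Fin (Module.finrank ℂ (Module.End.eigenspace (S : E →ₗ[ℂ] E) μ)) →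
      Module.End.eigenspace (S : E →ₗ[ℂ] E) μ := fun μ =>
    stdOrthonormalBasis ℂ (Module.End.eigenspace (S : E →ₗ[ℂ] E) μ)
  have horth : Orthonormal ℂ fun a : Σ μ : ℂ, Fin (Module.finrank ℂ
      (Module.End.eigenspace (S : E →ₗ[ℂ] E) μ)) => (v a.1 a.2 : E) :=
    hsymm.orthogonalFamily_eigenspaces.orthonormal_sigma_orthonormal
    (v_family := v) fun μ => (stdOrthonormalBasis ℂ _).orthonormal
  have hbot : (Submodule.span ℂ (Set.range fun a : Σ μ : ℂ, Fin (Module.finrank ℂ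
      (Module.End.eigenspace (S : E →ₗ[ℂ] E) μ)) => (v a.1 a.2 : E)))ᗮ = ⊥ := by
    rw [eq_bot_iff, ← S.orthogonalComplement_iSup_eigenspaces_eq_bot hS hsymm]
    refine Submodule.orthogonal_le (iSup_le fun μ x hx => ?_)
    have := (stdOrthonormalBasis ℂ (Module.End.eigenspace (S : E →ₗ[ℂ] E) μ)).sum_repr ⟨x, hx⟩
    have hx' := congrArg Subtype.val this
    simp only [Submodule.coe_sum, Submodule.coe_smul] at hx'
    rw [← hx']
    exact Submodule.sum_mem _ fun i _ => Submodule.smul_mem _ _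
      (Submodule.subset_span ⟨⟨μ, i⟩, rfl⟩)
  let e := HilbertBasis.mkOfOrthogonalEqBot horth hbot
  have hev : ∀ a, S (e a) = a.1 • e a := fun a => by
    have h1 : e a = (v a.1 a.2 : E) :=
      congrFun (HilbertBasis.coe_mkOfOrthogonalEqBot horth hbot) a
    rw [h1]
    exact Module.End.mem_eigenspace_iff.1 (v a.1 a.2).2
  have hne : ∀ a, e a ≠ 0 := fun a => e.orthonormal.ne_zero a
  refine ⟨_, e, fun a => a.1.re, fun a => ?_⟩
  have hreal : ((a.1.re : ℝ) : ℂ) = a.1 := by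
    have := hsymm (e a) (e a)
    simp only [ContinuousLinearMap.coe_coe, hev, inner_smul_left, inner_smul_right] at this
    exact Complex.conj_eq_iff_re.1 (mul_right_cancel₀ (inner_self_ne_zero.2 (hne a)) this)
  refine ⟨fun (h0 : a.1.re = 0) => hne a (hinj ?_), by rw [hreal, hev]⟩
  rw [map_zero, hev, ← hreal, h0]
  simp

/-- A bounded symmetric perturbation of a diagonal operator with discrete spectrum has a Hilbert
basis of eigenvectors. -/
theorem exists_hilbertBasis_diagRel [CompleteSpace E] {ι : Type*} (h : HilbertBasis ι ℂ E)
    {d : ι → ℝ} (hd0 : ∀ n, 0 ≤ d n) (hd : Filter.Tendsto d Filter.cofinite Filter.atTop)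
    (Q : E →L[ℂ] E) (hQ : ∀ u v, ⟪Q u, v⟫ = ⟪u, Q v⟫) :
    ∃ (κ : Type) (e : HilbertBasis κ ℂ E) (l : κ → ℝ),
      ∀ i, DiagRel h d (e i) ((l i : ℂ) • e i - Q (e i)) := by
  -- With this shift `T = (D + k)⁻¹` satisfies `‖T ∘L Q‖ ≤ ‖Q‖ / (‖Q‖ + 1) < 1`, so `1 + T Q` is
  -- invertible by a Neumann series and `S = (1 + T Q)⁻¹ T` inverts `D + Q + k`.
  set k : ℝ := ‖Q‖ + 1 with hk
  have hk0 : 0 < k := by positivity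
  let t : ι → ℝ := fun n => (d n + k)⁻¹
  have hpos : ∀ n, 0 < d n + k := fun n => by linarith [hd0 n]
  have ht : ∀ n, |t n| ≤ k⁻¹ := fun n => by
    rw [abs_of_pos (inv_pos.2 (hpos n))]
    exact inv_anti₀ hk0 (by linarith [hd0 n])
  have ht0 : Filter.Tendsto t Filter.cofinite (nhds 0) :=
    (Filter.tendsto_atTop_add_const_right _ k hd).inv_tendsto_atTop
  set T := h.diagonal t (inv_pos.2 hk0).le ht with hT
  have hTc : IsCompactOperator T := h.isCompactOperator_diagonal t _ ht ht0
  have hTn : ‖T‖ ≤ k⁻¹ := h.norm_diagonal_le _ _ _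
  have hlt : ‖-(T ∘L Q)‖ < 1 := by
    rw [norm_neg]
    calc ‖T ∘L Q‖ ≤ ‖T‖ * ‖Q‖ := ContinuousLinearMap.opNorm_comp_le _ _
      _ ≤ k⁻¹ * ‖Q‖ := by gcongr
      _ < 1 := by rw [inv_mul_lt_one₀ hk0]; linarith
  let U := Units.oneSub _ hlt
  have hU : ∀ u, (U : E →L[ℂ] E) u = u + T (Q u) := fun u => by
    simp [U]
  let S : E →L[ℂ] E := (↑U⁻¹ : E →L[ℂ] E) ∘L T
  have hrel : ∀ u g, u = S g ↔ DiagRel h d u (g - (k : ℂ) • u - Q u) := fun u g => by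
    have h1 : u = S g ↔ u + T (Q u) = T g := by
      rw [← hU]
      constructor
      · rintro rfl
        change ((U : E →L[ℂ] E) * (↑U⁻¹ : E →L[ℂ] E)) (T g) = T g
        rw [U.mul_inv]
        rfl
      · intro hu
        change u = (↑U⁻¹ : E →L[ℂ] E) (T g)
        rw [← hu]
        change u = ((↑U⁻¹ : E →L[ℂ] E) * (U : E →L[ℂ] E)) u
        rw [U.inv_mul]
        rfl
    have h2 : u + T (Q u) = T g ↔ ∀ n, ⟪h n, u + T (Q u)⟫ = ⟪h n, T g⟫ :=
      ⟨fun hu n => by rw [hu], h.ext_inner⟩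
    rw [h1, h2]
    refine forall_congr' fun n => ?_
    have hne : ((d n + k : ℝ) : ℂ) ≠ 0 := Complex.ofReal_ne_zero.2 (hpos n).ne'
    rw [inner_add_right, hT, h.inner_diagonal, h.inner_diagonal, inner_sub_right, inner_sub_right,
      inner_smul_right]
    simp only [t, Complex.ofReal_inv]
    rw [← mul_right_inj' hne, mul_add, mul_inv_cancel_left₀ hne, mul_inv_cancel_left₀ hne]
    push_cast
    constructor <;> intro hh <;> linear_combination -hh
  have hsymm : (S : E →ₗ[ℂ] E).IsSymmetric := fun f g => by
    have := ((hrel _ f).1 rfl).inner_comm ((hrel _ g).1 rfl)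
    simp only [inner_sub_left, inner_sub_right, inner_smul_left, inner_smul_right,
      Complex.conj_ofReal, hQ] at this
    simp only [ContinuousLinearMap.coe_coe]
    linear_combination this
  have hinj : Function.Injective S := by
    refine (injective_iff_map_eq_zero S).2 fun g hg => h.ext_inner fun n => ?_
    have := (hrel 0 g).1 hg.symm n
    simpa using this
  obtain ⟨κ, e, s, hs⟩ := (hTc.clm_comp (↑U⁻¹ : E →L[ℂ] E) :
    IsCompactOperator S).exists_hilbertBasis_eigenvectors hsymm hinj
  -- An eigenvalue `s` of `(D + Q + k)⁻¹` corresponds to the eigenvalue `s⁻¹ - k` of `D + Q`.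
  refine ⟨κ, e, fun i => (s i)⁻¹ - k, fun i n => ?_⟩
  obtain ⟨hs0, hse⟩ := hs i
  have hs0' : (s i : ℂ) ≠ 0 := Complex.ofReal_ne_zero.2 hs0
  have := (hrel _ (e i)).1 rfl n
  simp only [hse, map_smul, inner_sub_right, inner_smul_right] at this ⊢
  push_cast
  rw [← mul_right_inj' hs0']
  linear_combination this + ⟪h n, e i⟫ * mul_inv_cancel₀ hs0'

end Abstract

/-! ### Multiplicities, and the comparison of eigenvalue sequences. -/

lemma LinearPMap.mem_eigenspace_iff {E : Type*} [AddCommGroup E] [Module ℂ E] (A : E →ₗ.[ℂ] E)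
    (μ : ℂ) (u : E) : u ∈ A.eigenspace μ ↔ (u, μ • u) ∈ A.graph := by
  rw [LinearPMap.mem_graph_iff]
  constructor
  · rintro ⟨hu, hu'⟩
    exact ⟨⟨u, hu⟩, rfl, hu'⟩
  · rintro ⟨⟨v, hv⟩, rfl, hv'⟩
    exact ⟨hv, hv'⟩

/-- If the graph of `A` is that of a diagonal operator whose entries have finite multiplicity, the
multiplicities of the eigenvalues of `A` are those of the entries. -/
lemma rank_eigenspace_of_diagRel {κ : Type} {A : L2R →ₗ.[ℂ] L2R} {e : HilbertBasis κ ℂ L2R}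
    {l : κ → ℝ} (hA : ∀ i, (e i, (l i : ℂ) • e i) ∈ A.graph)
    (hA' : ∀ u f, (u, f) ∈ A.graph → DiagRel e l u f) (hfin : ∀ c, {i | l i = c}.Finite) (μ : ℂ) :
    Module.rank ℂ (A.eigenspace μ) = Cardinal.mk {i // (l i : ℂ) = μ} := by
  have hspan : A.eigenspace μ = Submodule.span ℂ (Set.range fun i : {i // (l i : ℂ) = μ} => e i) := by
    refine le_antisymm (fun u hu => ?_) (Submodule.span_le.2 ?_)
    · rw [LinearPMap.mem_eigenspace_iff] at hu
      have h0 : ∀ i, (l i : ℂ) ≠ μ → inner ℂ (e i) u = 0 := fun i hi => by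
        have := hA' _ _ hu i
        rw [inner_smul_right] at this
        by_contra h0
        exact hi (mul_right_cancel₀ h0 this).symm
      -- Finiteness reduces the expansion of `u` to a finite sum, so the algebraic span suffices
      -- without closure.
      have hfin' : {i | (l i : ℂ) = μ}.Finite := (hfin μ.re).subset fun i hi => by
        have := congrArg Complex.re (show (l i : ℂ) = μ from hi)
        simpa using this
      have hsum := e.hasSum_repr u
      have hsum' := hasSum_sum_of_ne_finset_zero (L := SummationFilter.unconditional κ)
        (f := fun i => e.repr u i • e i)
        (s := hfin'.toFinset) fun i hi => by
          rw [e.repr_apply_apply, h0 i (by simpa using hi), zero_smul]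
      rw [hsum.unique hsum']
      refine Submodule.sum_mem _ fun i hi => Submodule.smul_mem _ _ (Submodule.subset_span ?_)
      exact ⟨⟨i, by simpa using hi⟩, rfl⟩
    · rintro _ ⟨i, rfl⟩
      change e i ∈ A.eigenspace μ
      have := hA i
      rwa [i.2, ← LinearPMap.mem_eigenspace_iff] at this
  have hli := (e.orthonormal.comp (fun i : {i // (l i : ℂ) = μ} => (i : κ))
    Subtype.val_injective).linearIndependent
  rw [hspan]
  exact rank_span hli |>.trans (Cardinal.mk_range_eq _ hli.injective)

/-- A bounded symmetric perturbation, with form bounds `m` and `M`, of an operator with eigenvalues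
`d 0 ≤ d 1 ≤ …` has eigenvalues between `d n + m` and `d n + M`. -/
theorem eigenvalueSequence_of_perturbation {A : L2R →ₗ.[ℂ] L2R} (h : HilbertBasis ℕ ℂ L2R)
    {d : ℕ → ℝ} (hd0 : 0 ≤ d 0) (hdm : Monotone d) (hd : Filter.Tendsto d Filter.atTop Filter.atTop)
    (Q : L2R →L[ℂ] L2R) (hQ : ∀ u v, inner ℂ (Q u) v = inner ℂ u (Q v)) {m M : ℝ}
    (hm : ∀ u, m * ‖u‖ ^ 2 ≤ (inner ℂ u (Q u)).re) (hM : ∀ u, (inner ℂ u (Q u)).re ≤ M * ‖u‖ ^ 2)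
    (hA : ∀ u f, (u, f) ∈ A.graph ↔ DiagRel h d u (f - Q u)) :
    (∃ lam : ℕ → ℝ, IsEigenvalueSequence A lam) ∧
      ∀ lam : ℕ → ℝ, IsEigenvalueSequence A lam → ∀ n, d n + m ≤ lam n ∧ lam n ≤ d n + M := by
  obtain ⟨κ, e, l, he⟩ := exists_hilbertBasis_diagRel h (fun n => hd0.trans (hdm n.zero_le))
    (by rwa [Nat.cofinite_eq_atTop]) Q hQ
  have hinf : Infinite κ := by
    by_contra hfin
    rw [not_infinite_iff_finite] at hfin
    have := Fintype.ofFinite κ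
    -- With `F` the whole finite index set, the condition on `L` is vacuous, so any `L` above `d
    -- (card κ) + M` gives a contradiction.
    have := eigenvalue_le_of_card_lt hQ he hM (J := Finset.range (Fintype.card κ + 1))
      (F := Finset.univ) (by simp) (D := d (Fintype.card κ)) (L := d (Fintype.card κ) + M + 1)
      (fun n hn => hdm (Nat.lt_succ_iff.1 (Finset.mem_range.1 hn))) (by simp)
    linarith
  have hsub : ∀ c, {i | l i ≤ c}.Finite := fun c => by
    by_contra hc
    obtain ⟨N, hN⟩ := (hd.eventually_gt_atTop (c - m)).exists
    obtain ⟨J, hJ, hJc⟩ := Set.Infinite.exists_subset_card_eq hc (N + 1)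
    have := le_eigenvalue_of_card_lt he hm (J := J) (F := Finset.range N) (D := d N) (L := c)
      (by simp [hJc]) (fun n hn => hdm (by simpa using hn)) (fun i hi => hJ hi)
    linarith
  have hAe : ∀ i, (e i, (l i : ℂ) • e i) ∈ A.graph := fun i => (hA _ _).2 (he i)
  -- Symmetry of the unperturbed operator, applied to `e i` and `u`, shows that every pair in the
  -- graph is diagonal in `e`.
  have hAl : ∀ u f, (u, f) ∈ A.graph → DiagRel e l u f := fun u f huf i => by
    have := ((he i).inner_comm ((hA _ _).1 huf))
    simp only [inner_sub_left, inner_sub_right, inner_smul_left, Complex.conj_ofReal, hQ] at this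
    exact sub_left_injective this
  have hrank := rank_eigenspace_of_diagRel hAe hAl fun c => (hsub c).subset fun i hi => le_of_eq hi
  constructor
  · obtain ⟨σ, hσ⟩ := exists_equiv_nat_monotone l hsub
    refine ⟨l ∘ σ, hσ, fun μ => ?_⟩
    rw [hrank]
    exact (Cardinal.mk_congr (σ.subtypeEquiv fun n => Iff.rfl)).symm
  · rintro lam ⟨hmono, hlam⟩
    -- Any eigenvalue sequence takes each value as often as `l` does; gluing bijections of fibres
    -- identifies its indices with those of the eigenbasis.
    have hfib : ∀ c : ℝ, Nonempty ({n // lam n = c} ≃ {i // l i = c}) := fun c => by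
      have := (hlam c).symm.trans (hrank c)
      simp only [Complex.ofReal_inj] at this
      exact Cardinal.eq.1 this
    let τ := fun c => Classical.choice (hfib c)
    let σ : ℕ ≃ κ := (Equiv.sigmaFiberEquiv lam).symm.trans
      ((Equiv.sigmaCongrRight τ).trans (Equiv.sigmaFiberEquiv l))
    have hσ : ∀ n, l (σ n) = lam n := fun n => (τ (lam n) ⟨n, rfl⟩).2
    classical
    intro n
    constructor
    -- The `n + 1` eigenvectors for `lam 0, …, lam n` are set against the `n` conditions that remove
    -- `d 0, …, d (n - 1)`; the upper bound exchanges the roles.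
    · refine le_eigenvalue_of_card_lt he hm (J := (Finset.range (n + 1)).map σ.toEmbedding)
        (F := Finset.range n) (by simp) (fun k hk => hdm (by simpa using hk)) fun i hi => ?_
      obtain ⟨k, hk, rfl⟩ := Finset.mem_map.1 hi
      exact (hσ k).trans_le (hmono (Nat.lt_succ_iff.1 (Finset.mem_range.1 hk)))
    · refine eigenvalue_le_of_card_lt hQ he hM (J := Finset.range (n + 1))
        (F := (Finset.range n).map σ.toEmbedding) (by simp)
        (fun k hk => hdm (Nat.lt_succ_iff.1 (Finset.mem_range.1 hk))) fun i hi => ?_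
      obtain ⟨k, rfl⟩ := σ.surjective i
      rw [hσ]
      refine hmono (not_lt.1 fun hlt => hi ?_)
      exact Finset.mem_map.2 ⟨k, Finset.mem_range.2 hlt, rfl⟩

/-! ### Hermite functions and their totality. -/

section GaussPoly

open Polynomial Real

/-- The function `p(y) exp(-a y² / 4)`. -/
noncomputable def gaussPoly (a : ℝ) (p : ℝ[X]) (y : ℝ) : ℝ := p.eval y * exp (-(a / 4) * y ^ 2)

/-- The polynomial factor of the derivative of `gaussPoly a p`. -/
noncomputable def gaussDeriv (a : ℝ) (p : ℝ[X]) : ℝ[X] := derivative p - C (a / 2) * X * p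

/-- The Hermite operator `-p'' + a X p'`. -/
noncomputable def hermiteOp (a : ℝ) (p : ℝ[X]) : ℝ[X] :=
  -derivative (derivative p) + C a * X * derivative p

/-- The Hermite polynomials adapted to the weight `exp(-a y² / 2)`. -/
noncomputable def hermitePoly (a : ℝ) : ℕ → ℝ[X]
  | 0 => 1
  | n + 1 => C a * X * hermitePoly a n - derivative (hermitePoly a n)

/-- The two identities are proved jointly: the eigenvalue equation at `n` gives the derivative
formula at `n`, which gives the eigenvalue equation at `n + 1`. -/
lemma hermiteOp_derivative_hermitePoly (a : ℝ) (n : ℕ) :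
    hermiteOp a (hermitePoly a n) = C (n * a) * hermitePoly a n ∧
      derivative (hermitePoly a (n + 1)) = C ((n + 1) * a) * hermitePoly a n := by
  have key : ∀ n, hermiteOp a (hermitePoly a n) = C (n * a) * hermitePoly a n →
      derivative (hermitePoly a (n + 1)) = C ((n + 1) * a) * hermitePoly a n := fun n h => by
    simp only [hermiteOp, map_mul, map_natCast] at h
    simp only [hermitePoly, derivative_sub, derivative_mul, derivative_C, derivative_X, map_mul,
      map_add, map_natCast, map_one]
    linear_combination h
  induction n with
  | zero =>
    have h0 : hermiteOp a (hermitePoly a 0) = C ((0 : ℕ) * a) * hermitePoly a 0 := by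
      simp [hermiteOp, hermitePoly]
    exact ⟨h0, key 0 h0⟩
  | succ n ih =>
    have h1 : hermiteOp a (hermitePoly a (n + 1))
        = C ((n + 1 : ℕ) * a) * hermitePoly a (n + 1) := by
      rw [hermiteOp, ih.2, derivative_C_mul]
      simp only [hermitePoly, map_mul, Nat.cast_add, Nat.cast_one, map_add, map_natCast, map_one]
      ring
    exact ⟨h1, key _ h1⟩

lemma hermitePoly_ne_zero {a : ℝ} (ha : 0 < a) (n : ℕ) : hermitePoly a n ≠ 0 := by
  induction n with
  | zero => simp [hermitePoly]
  | succ n ih =>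
    intro h
    have := (hermiteOp_derivative_hermitePoly a n).2
    rw [h, derivative_zero, eq_comm, mul_eq_zero, C_eq_zero] at this
    rcases this with h0 | h0
    · have : 0 < ((n : ℝ) + 1) * a := by positivity
      exact this.ne' h0
    · exact ih h0

/-- The Hermite polynomials span all polynomials. -/
lemma hermitePoly_span {a : ℝ} (ha : 0 < a) (K : Submodule ℝ ℝ[X]) (hK : ∀ n, hermitePoly a n ∈ K)
    (p : ℝ[X]) : p ∈ K := by
  let S := Submodule.span ℝ (Set.range (hermitePoly a))
  suffices p ∈ S from Submodule.span_le.2 (Set.range_subset_iff.2 hK) this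
  have hh : ∀ n, hermitePoly a n ∈ S := fun n => Submodule.subset_span ⟨n, rfl⟩
  have hXn : ∀ n, X * hermitePoly a n ∈ S := fun n => by
    have hd : derivative (hermitePoly a n) ∈ S := by
      cases n with
      | zero => simp [hermitePoly]
      | succ n =>
        rw [(hermiteOp_derivative_hermitePoly a n).2, ← smul_eq_C_mul]
        exact S.smul_mem _ (hh n)
    have h2 : X * hermitePoly a n
        = a⁻¹ • (hermitePoly a (n + 1) + derivative (hermitePoly a n)) := by
      rw [hermitePoly, sub_add_cancel, smul_eq_C_mul, ← mul_assoc, ← mul_assoc, ← C_mul,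
        inv_mul_cancel₀ ha.ne', C_1, one_mul]
    rw [h2]
    exact S.smul_mem _ (S.add_mem (hh _) hd)
  have hX : ∀ q ∈ S, X * q ∈ S := fun q hq => by
    induction hq using Submodule.span_induction with
    | mem q hq => obtain ⟨n, rfl⟩ := hq; exact hXn n
    | zero => simp
    | add q r _ _ h1 h2 => rw [mul_add]; exact S.add_mem h1 h2
    | smul c q _ h1 => rw [mul_smul_comm]; exact S.smul_mem c h1
  have hpow : ∀ n, (X : ℝ[X]) ^ n ∈ S := fun n => by
    induction n with
    | zero => exact hh 0
    | succ n ih => rw [pow_succ']; exact hX _ ih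
  induction p using Polynomial.induction_on' with
  | add p q hp hq => exact S.add_mem hp hq
  | monomial n c =>
    rw [← C_mul_X_pow_eq_monomial, ← smul_eq_C_mul]
    exact S.smul_mem c (hpow n)

lemma hasDerivAt_gaussPoly (a : ℝ) (p : ℝ[X]) (y : ℝ) :
    HasDerivAt (gaussPoly a p) (gaussPoly a (gaussDeriv a p) y) y := by
  have h1 : HasDerivAt (fun y : ℝ => -(a / 4) * y ^ 2) (-(a / 4) * (2 * y)) y := by
    simpa using (hasDerivAt_pow 2 y).const_mul (-(a / 4))
  refine HasDerivAt.congr_deriv (f := gaussPoly a p) ((p.hasDerivAt y).mul h1.exp) ?_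
  simp only [gaussPoly, gaussDeriv, eval_sub, eval_mul, eval_C, eval_X]
  ring

lemma contDiff_gaussPoly (a : ℝ) (p : ℝ[X]) : ContDiff ℝ ∞ (gaussPoly a p) := by
  unfold gaussPoly
  exact (by simpa using p.contDiff_aeval (𝕜 := ℝ) (R := ℝ) ∞ : ContDiff ℝ ∞ fun y => p.eval y).mul
    (by fun_prop)

/-- The harmonic oscillator acts on `gaussPoly a p` as the Hermite operator acts on `p`. -/
lemma gaussPoly_hermiteOp (a : ℝ) (p : ℝ[X]) (y : ℝ) :
    -gaussPoly a (gaussDeriv a (gaussDeriv a p)) y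
      + (1 / 4 * a ^ 2 * y ^ 2 - a / 2) * gaussPoly a p y = gaussPoly a (hermiteOp a p) y := by
  simp only [gaussPoly, gaussDeriv, hermiteOp, derivative_sub, derivative_mul, derivative_C,
    derivative_X, eval_sub, eval_add, eval_mul, eval_neg, eval_C, eval_X, eval_zero, eval_one]
  ring

lemma integrable_gaussPoly {a : ℝ} (ha : 0 < a) (p : ℝ[X]) : Integrable (gaussPoly a p) := by
  induction p using Polynomial.induction_on' with
  | add p q hp hq =>
    have : gaussPoly a (p + q) = gaussPoly a p + gaussPoly a q := by
      ext y
      simp [gaussPoly, add_mul]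
    rw [this]
    exact hp.add hq
  | monomial n c =>
    have := (integrable_rpow_mul_exp_neg_mul_sq (b := a / 4) (by positivity) (s := n)
      (by have := n.cast_nonneg (α := ℝ); linarith)).const_mul c
    refine this.congr (Filter.Eventually.of_forall fun y => ?_)
    simp [gaussPoly, mul_assoc]

lemma memLp_gaussPoly {a : ℝ} (ha : 0 < a) (p : ℝ[X]) :
    MemLp (fun y => (gaussPoly a p y : ℂ)) 2 := by
  refine MemLp.ofReal (f := gaussPoly a p) ?_
  rw [memLp_two_iff_integrable_sq (contDiff_gaussPoly a p).continuous.aestronglyMeasurable]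
  -- Squaring doubles the Gaussian exponent.
  refine (integrable_gaussPoly (a := 2 * a) (by positivity) (p ^ 2)).congr
    (Filter.Eventually.of_forall fun y => ?_)
  simp only [gaussPoly, mul_pow, eval_pow, ← Real.exp_nat_mul]
  congr 2
  push_cast
  ring

lemma integrable_memLp_mul_L2R {g : ℝ → ℂ} (hg : MemLp g 2) (u : L2R) :
    Integrable (fun y => g y * u y) :=
  hg.integrable_mul (Lp.memLp u)

lemma inner_toLp_ofReal {g : ℝ → ℝ} (hg : MemLp (fun y => (g y : ℂ)) 2) (u : L2R) :
    inner ℂ (hg.toLp _) u = ∫ y, (g y : ℂ) * u y := by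
  rw [L2.inner_def]
  refine integral_congr_ae ?_
  filter_upwards [hg.coeFn_toLp] with y hy
  rw [hy, RCLike.inner_apply, Complex.conj_ofReal, mul_comm]

open scoped FourierTransform

/-- An integrable function with vanishing Fourier transform vanishes almost everywhere. -/
lemma ae_eq_zero_of_fourier_eq_zero {g : ℝ → ℂ} (hg : Integrable g) (h : ∀ w, 𝓕 g w = 0) :
    ∀ᵐ y, g y = 0 := by
  refine ae_eq_zero_of_integral_contDiff_smul_eq_zero hg.locallyIntegrable fun φ hφ hc => ?_
  have hφ' : ContDiff ℝ ∞ (fun y => (φ y : ℂ)) := Complex.ofRealCLM.contDiff.comp hφ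
  have hc' : HasCompactSupport (fun y => (φ y : ℂ)) := hc.comp_left Complex.ofReal_zero
  let s := hc'.toSchwartzMap hφ'
  let ψ : SchwartzMap ℝ ℂ := 𝓕⁻ s
  have hψ : 𝓕 (⇑ψ) = s := by
    rw [← SchwartzMap.fourier_coe]
    exact congrArg _ (FourierTransform.fourier_fourierInv_eq s)
  -- The test function is the transform of `ψ`, so the transform can be moved onto `g`, where it
  -- vanishes.
  have h1 : ∫ w, 𝓕 g w • ψ w = ∫ y, g y • 𝓕 (⇑ψ) y := by
    have := VectorFourier.integral_fourierIntegral_smul_eq_flip (L := innerₗ ℝ) (ν := volume)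
      Real.continuous_fourierChar continuous_inner hg ψ.integrable
    rw [flip_innerₗ] at this
    exact this
  simp only [h, zero_smul, integral_zero, hψ] at h1
  rw [h1]
  refine integral_congr_ae (Filter.Eventually.of_forall fun y => ?_)
  simp [s, mul_comm]

lemma memLp_exp_mul_abs_mul_exp_neg_sq {a : ℝ} (ha : 0 < a) (c : ℝ) :
    MemLp (fun y => exp (c * |y|) * exp (-(a / 4) * y ^ 2)) 2 := by
  have h1 := (memLp_gaussPoly (a := a / 2) (by positivity) 1).norm.const_mul (exp (2 * c ^ 2 / a))
  refine MemLp.mono' h1 (by fun_prop) (Filter.Eventually.of_forall fun y => ?_)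
  simp only [gaussPoly, eval_one, one_mul, Complex.norm_real, Real.norm_eq_abs,
    abs_exp, ← Real.exp_add]
  refine Real.exp_le_exp.2 ?_
  -- Completing the square: `c |y| ≤ a y² / 8 + 2 c² / a`, which spends half of the Gaussian decay.
  have h2 : 0 ≤ (a * |y| - 4 * c) ^ 2 / (8 * a) := by positivity
  have h3 : (a * |y| - 4 * c) ^ 2 / (8 * a) = a / 8 * y ^ 2 - c * |y| + 2 * c ^ 2 / a := by
    rw [← sq_abs y]
    field_simp
    ring
  linarith

/-- The Fourier transform of a function with exponential decay is determined by its moments. -/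
lemma fourier_eq_zero_of_moments {g : ℝ → ℂ} (hg : Integrable g)
    (hgi : ∀ c, Integrable fun y => exp (c * |y|) * ‖g y‖)
    (hm : ∀ n : ℕ, ∫ y : ℝ, (y : ℂ) ^ n * g y = 0)
    (w : ℝ) : 𝓕 g w = 0 := by
  rw [Real.fourier_real_eq_integral_exp_smul]
  obtain ⟨z, hz⟩ : ∃ z : ℂ, ∀ y : ℝ, ((-2 * π * y * w : ℝ) : ℂ) * Complex.I = z * y :=
    ⟨((-2 * π * w : ℝ) : ℂ) * Complex.I, fun y => by push_cast; ring⟩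
  simp only [hz]
  have hexp : ∀ x : ℝ, HasSum (fun n : ℕ => x ^ n / n.factorial) (exp x) := fun x => by
    rw [Real.exp_eq_exp_ℝ]
    exact NormedSpace.expSeries_div_hasSum_exp x
  have hexpC : ∀ x : ℂ, HasSum (fun n : ℕ => x ^ n / n.factorial) (Complex.exp x) := fun x => by
    rw [Complex.exp_eq_exp_ℂ]
    exact NormedSpace.expSeries_div_hasSum_exp x
  have hbound : ∀ y : ℝ, HasSum (fun n : ℕ => (‖z‖ * |y|) ^ n / n.factorial * ‖g y‖)
      (exp (‖z‖ * |y|) * ‖g y‖) := fun y => (hexp _).mul_right _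
  have hF : ∀ n : ℕ, ∫ y : ℝ, (z * y) ^ n / n.factorial * g y = 0 := fun n => by
    have h1 : ∀ y : ℝ, (z * y) ^ n / n.factorial * g y
        = z ^ n / n.factorial * ((y : ℂ) ^ n * g y) := fun y => by ring
    simp_rw [h1]
    rw [integral_const_mul, hm, mul_zero]
  -- The exponential series is integrated termwise, dominated by `exp (‖z‖ |y|) ‖g y‖`; each term is
  -- a multiple of a vanishing moment.
  have hsum := hasSum_integral_of_dominated_convergence (μ := volume)
    (F := fun (n : ℕ) (y : ℝ) => (z * y) ^ n / n.factorial * g y)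
    (f := fun y => Complex.exp (z * y) • g y)
    (fun n y => (‖z‖ * |y|) ^ n / n.factorial * ‖g y‖)
    (fun n => (by fun_prop : Continuous fun y : ℝ =>
      (z * y) ^ n / (n.factorial : ℂ)).aestronglyMeasurable.mul hg.aestronglyMeasurable)
    (fun n => Filter.Eventually.of_forall fun y => by simp)
    (Filter.Eventually.of_forall fun y => (hbound y).summable)
    ((hgi ‖z‖).congr (Filter.Eventually.of_forall fun y => (hbound y).tsum_eq.symm))
    (Filter.Eventually.of_forall fun y => (hexpC _).mul_right _)
  simp only [hF] at hsum
  exact hsum.unique hasSum_zero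

/-- The functions `gaussPoly a p` are total in `L²`. -/
lemma eq_zero_of_integral_gaussPoly {a : ℝ} (ha : 0 < a) (u : L2R)
    (hu : ∀ p, ∫ y, (gaussPoly a p y : ℂ) * u y = 0) : u = 0 := by
  have hgi : ∀ c, Integrable fun y => exp (c * |y|) * ‖(exp (-(a / 4) * y ^ 2) : ℂ) * u y‖ :=
    fun c => by
      have := (integrable_memLp_mul_L2R (memLp_exp_mul_abs_mul_exp_neg_sq ha c).ofReal u).norm
      refine this.congr (Filter.Eventually.of_forall fun y => ?_)
      simp [mul_assoc, Complex.norm_exp]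
  have hg : Integrable fun y => (exp (-(a / 4) * y ^ 2) : ℂ) * u y := by
    have := integrable_memLp_mul_L2R (memLp_gaussPoly ha 1) u
    refine this.congr (Filter.Eventually.of_forall fun y => ?_)
    simp [gaussPoly]
  have hF := fourier_eq_zero_of_moments hg hgi fun n => by
    rw [← hu (X ^ n)]
    refine integral_congr_ae (Filter.Eventually.of_forall fun y => ?_)
    simp [gaussPoly, mul_assoc]
  refine Lp.eq_zero_iff_ae_eq_zero.2 ((ae_eq_zero_of_fourier_eq_zero hg hF).mono fun y hy => ?_)
  exact (mul_eq_zero.1 hy).resolve_left (Complex.ofReal_ne_zero.2 (exp_pos _).ne')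

end GaussPoly

/-! ### The weak oscillator equation tested with Gaussian functions. -/

section Oscillator

open Polynomial Filter Topology

/-- The potential `a² y² / 4 - a / 2` of the harmonic oscillator with eigenvalues `n a`. -/
noncomputable def oscPotential (a y : ℝ) : ℝ := 1 / 4 * a ^ 2 * y ^ 2 - a / 2

lemma continuous_oscPotential (a : ℝ) : Continuous (oscPotential a) := by
  unfold oscPotential
  fun_prop

lemma gaussPoly_C_mul (a c : ℝ) (p : ℝ[X]) (y : ℝ) :
    gaussPoly a (C c * p) y = c * gaussPoly a p y := by
  simp [gaussPoly, mul_assoc]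

lemma L2R.locallyIntegrable_mul {V : ℝ → ℝ} (hV : Continuous V) (u : L2R) :
    LocallyIntegrable fun y => (V y : ℂ) * u y :=
  locallyIntegrableOn_univ.1 <| LocallyIntegrableOn.continuousOn_mul
    (locallyIntegrableOn_univ.2 u.locallyIntegrable)
    (Complex.continuous_ofReal.comp hV).continuousOn isOpen_univ.isLocallyClosed

lemma integral_deriv_mul_gaussPoly (a : ℝ) (p : ℝ[X]) {φ : ℝ → ℝ} (hφ : ContDiff ℝ 1 φ)
    (hc : HasCompactSupport φ) :
    ∫ y, deriv φ y * gaussPoly a p y = -∫ y, φ y * gaussPoly a (gaussDeriv a p) y := by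
  have hG := fun p => (contDiff_gaussPoly a p).continuous
  have h1 := integral_mul_deriv_eq_deriv_mul_of_integrable (u := φ) (v := gaussPoly a p)
    (fun y _ => (hφ.differentiable one_ne_zero y).hasDerivAt)
    (fun y _ => hasDerivAt_gaussPoly a p y)
    ((hφ.continuous.mul (hG _)).integrable_of_hasCompactSupport hc.mul_right)
    (((hφ.continuous_deriv le_rfl).mul (hG _)).integrable_of_hasCompactSupport hc.deriv.mul_right)
    ((hφ.continuous.mul (hG _)).integrable_of_hasCompactSupport hc.mul_right)
  rw [h1, neg_neg]

/-- The function `gaussPoly a p` as an element of `L²`. -/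
noncomputable def gaussL2 {a : ℝ} (ha : 0 < a) (p : ℝ[X]) : L2R := (memLp_gaussPoly ha p).toLp _

lemma coeFn_gaussL2 {a : ℝ} (ha : 0 < a) (p : ℝ[X]) :
    gaussL2 ha p =ᵐ[volume] fun y => (gaussPoly a p y : ℂ) :=
  (memLp_gaussPoly ha p).coeFn_toLp

lemma inner_gaussL2 {a : ℝ} (ha : 0 < a) (p : ℝ[X]) (u : L2R) :
    inner ℂ (gaussL2 ha p) u = ∫ y, (gaussPoly a p y : ℂ) * u y :=
  inner_toLp_ofReal _ u

lemma gaussL2_C_mul {a : ℝ} (ha : 0 < a) (c : ℝ) (p : ℝ[X]) :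
    gaussL2 ha (C c * p) = (c : ℂ) • gaussL2 ha p := by
  refine Lp.ext ?_
  filter_upwards [coeFn_gaussL2 ha (C c * p), coeFn_gaussL2 ha p,
    Lp.coeFn_smul (c : ℂ) (gaussL2 ha p)] with y h1 h2 h3
  rw [h1, h3, Pi.smul_apply, h2, gaussPoly_C_mul]
  simp

lemma weakEq_gaussL2 {a : ℝ} (ha : 0 < a) (p : ℝ[X]) :
    WeakEq (oscPotential a) (gaussL2 ha p) (gaussL2 ha (hermiteOp a p)) := by
  refine ⟨L2R.locallyIntegrable_mul (continuous_oscPotential a) _, fun φ hφ hc => ?_⟩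
  have hG := fun p => (contDiff_gaussPoly a p).continuous
  have hφ1 : ContDiff ℝ 1 φ := hφ.of_le (mod_cast le_top)
  have hφ2 : ContDiff ℝ 1 (deriv φ) := (contDiff_infty_iff_deriv.1 hφ).2.of_le (mod_cast le_top)
  have key : -(∫ y, deriv (deriv φ) y * gaussPoly a p y)
      + ∫ y, φ y * (oscPotential a y * gaussPoly a p y)
        = ∫ y, φ y * gaussPoly a (hermiteOp a p) y := by
    rw [integral_deriv_mul_gaussPoly a p hφ2 hc.deriv, integral_deriv_mul_gaussPoly a _ hφ1 hc,
      neg_neg, ← integral_neg, ← integral_add]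
    · refine integral_congr_ae (Eventually.of_forall fun y => ?_)
      simp only [← gaussPoly_hermiteOp, oscPotential]
      ring
    · exact ((hφ.continuous.mul (hG _)).integrable_of_hasCompactSupport hc.mul_right).neg
    · exact (hφ.continuous.mul ((continuous_oscPotential a).mul
        (hG _))).integrable_of_hasCompactSupport hc.mul_right
  have e1 : ∫ y, ((deriv (deriv φ) y : ℝ) : ℂ) * gaussL2 ha p y
      = ((∫ y, deriv (deriv φ) y * gaussPoly a p y : ℝ) : ℂ) := by
    rw [← integral_complex_ofReal]
    refine integral_congr_ae ?_
    filter_upwards [coeFn_gaussL2 ha p] with y hy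
    rw [hy]
    push_cast
    rfl
  have e2 : ∫ y, (φ y : ℂ) * ((oscPotential a y : ℂ) * gaussL2 ha p y)
      = ((∫ y, φ y * (oscPotential a y * gaussPoly a p y) : ℝ) : ℂ) := by
    rw [← integral_complex_ofReal]
    refine integral_congr_ae ?_
    filter_upwards [coeFn_gaussL2 ha p] with y hy
    rw [hy]
    push_cast
    rfl
  have e3 : ∫ y, (φ y : ℂ) * gaussL2 ha (hermiteOp a p) y
      = ((∫ y, φ y * gaussPoly a (hermiteOp a p) y : ℝ) : ℂ) := by
    rw [← integral_complex_ofReal]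
    refine integral_congr_ae ?_
    filter_upwards [coeFn_gaussL2 ha (hermiteOp a p)] with y hy
    rw [hy]
    push_cast
    rfl
  rw [e1, e2, e3, ← key]
  push_cast
  rfl

/-- Serves to remove the cutoff: it is applied to the cutoff and to its first two derivatives. -/
lemma tendsto_integral_comp_div_mul {β : ℝ → ℝ} (hβ : Continuous β) {K : ℝ} (hK : ∀ y, ‖β y‖ ≤ K)
    {w : ℝ → ℂ} (hw : Integrable w) :
    Tendsto (fun k : ℕ => ∫ y, (β (1 / ((k : ℝ) + 1) * y) : ℂ) * w y) atTop
      (𝓝 ((β 0 : ℂ) * ∫ y, w y)) := by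
  rw [← integral_const_mul]
  refine tendsto_integral_of_dominated_convergence (fun y => K * ‖w y‖) (fun k => ?_)
    (hw.norm.const_mul K) (fun k => Eventually.of_forall fun y => ?_)
    (Eventually.of_forall fun y => ?_)
  · exact (Complex.continuous_ofReal.comp (hβ.comp (by fun_prop))).aestronglyMeasurable.mul
      hw.aestronglyMeasurable
  · rw [norm_mul, Complex.norm_real]
    exact mul_le_mul_of_nonneg_right (hK _) (norm_nonneg _)
  · refine Tendsto.mul_const _ ((Complex.continuous_ofReal.tendsto _).comp
      ((hβ.tendsto 0).comp ?_))
    simpa using tendsto_one_div_add_atTop_nhds_zero_nat.mul_const y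

/-- In the weak equation one may test with `gaussPoly a p`. -/
lemma WeakEq.integral_hermiteOp {a : ℝ} (ha : 0 < a) {u f : L2R} (h : WeakEq (oscPotential a) u f)
    (p : ℝ[X]) :
    ∫ y, (gaussPoly a (hermiteOp a p) y : ℂ) * u y = ∫ y, (gaussPoly a p y : ℂ) * f y := by
  let b : ContDiffBump (0 : ℝ) := ⟨1, 2, one_pos, one_lt_two⟩
  let χ : ℝ → ℝ := b
  have hχ : ContDiff ℝ ∞ χ := b.contDiff
  have hχc : HasCompactSupport χ := b.hasCompactSupport
  have hχ0 : χ 0 = 1 := b.one_of_mem_closedBall (by simp [b])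
  have hχ1 : ContDiff ℝ ∞ (deriv χ) := (contDiff_infty_iff_deriv.1 hχ).2
  have hχ2 : Continuous (deriv (deriv χ)) := continuous_deriv_deriv hχ
  obtain ⟨K0, hK0⟩ := hχc.exists_bound_of_continuous hχ.continuous
  obtain ⟨K1, hK1⟩ := hχc.deriv.exists_bound_of_continuous hχ1.continuous
  obtain ⟨K2, hK2⟩ := hχc.deriv.deriv.exists_bound_of_continuous hχ2
  have hdχ : ∀ y, HasDerivAt χ (deriv χ y) y := fun y =>
    (hχ.differentiable (by simp) y).hasDerivAt
  have hdχ1 : ∀ y, HasDerivAt (deriv χ) (deriv (deriv χ) y) y := fun y =>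
    (hχ1.differentiable (by simp) y).hasDerivAt
  let p1 := gaussDeriv a p
  let p2 := gaussDeriv a p1
  have hi : ∀ (q : ℝ[X]) (w : L2R), Integrable fun y => (gaussPoly a q y : ℂ) * w y :=
    fun q w => integrable_memLp_mul_L2R (memLp_gaussPoly ha q) w
  have hib : ∀ {β : ℝ → ℝ} (_ : Continuous β) {K : ℝ} (_ : ∀ y, ‖β y‖ ≤ K) (ε : ℝ) (q : ℝ[X])
      (w : L2R), Integrable fun y => (β (ε * y) : ℂ) * ((gaussPoly a q y : ℂ) * w y) :=
    fun {β} hβ {K} hK ε q w => (hi q w).bdd_mul (c := K)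
      (Complex.continuous_ofReal.comp (hβ.comp (by fun_prop))).aestronglyMeasurable
      (Eventually.of_forall fun y => by rw [Complex.norm_real]; exact hK _)
  -- The test function is `χ (ε y)` times the Gaussian function. Derivatives falling on the cutoff
  -- carry factors `ε` or `ε²`, so these terms vanish as `ε → 0`.
  have key : ∀ ε : ℝ, ε ≠ 0 →
      (∫ y, (χ (ε * y) : ℂ) * ((gaussPoly a (hermiteOp a p) y : ℂ) * u y))
        - 2 * ε * (∫ y, ((deriv χ (ε * y) : ℝ) : ℂ) * ((gaussPoly a p1 y : ℂ) * u y))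
        - ε ^ 2 * (∫ y, ((deriv (deriv χ) (ε * y) : ℝ) : ℂ) * ((gaussPoly a p y : ℂ) * u y))
        = ∫ y, (χ (ε * y) : ℂ) * ((gaussPoly a p y : ℂ) * f y) := fun ε hε => by
    let φ : ℝ → ℝ := fun y => χ (ε * y) * gaussPoly a p y
    have hφ : ContDiff ℝ ∞ φ := (hχ.comp (by fun_prop)).mul (contDiff_gaussPoly a p)
    have hφc : HasCompactSupport φ :=
      (hχc.comp_homeomorph (Homeomorph.mulLeft₀ ε hε)).mul_right
    have hlin : ∀ y, HasDerivAt (fun y => ε * y) ε y := fun y => by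
      simpa using (hasDerivAt_id y).const_mul ε
    have hd1 : deriv φ = fun y => ε * deriv χ (ε * y) * gaussPoly a p y
        + χ (ε * y) * gaussPoly a p1 y := funext fun y => by
      refine (((hdχ _).comp y (hlin y)).mul (hasDerivAt_gaussPoly a p y)).deriv.trans ?_
      simp only [Function.comp_apply, p1]
      ring
    have hd2 : ∀ y, deriv (deriv φ) y = ε ^ 2 * deriv (deriv χ) (ε * y) * gaussPoly a p y
        + 2 * ε * deriv χ (ε * y) * gaussPoly a p1 y + χ (ε * y) * gaussPoly a p2 y := fun y => by
      rw [hd1]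
      refine (((((hdχ1 _).comp y (hlin y)).const_mul ε).mul (hasDerivAt_gaussPoly a p y)).add
        (((hdχ _).comp y (hlin y)).mul (hasDerivAt_gaussPoly a p1 y))).deriv.trans ?_
      simp only [Function.comp_apply, p1, p2]
      ring
    have hw := h.2 φ hφ hφc
    have e1 : ∫ y, ((deriv (deriv φ) y : ℝ) : ℂ) * u y
        = ε ^ 2 * (∫ y, ((deriv (deriv χ) (ε * y) : ℝ) : ℂ) * ((gaussPoly a p y : ℂ) * u y))
          + 2 * ε * (∫ y, ((deriv χ (ε * y) : ℝ) : ℂ) * ((gaussPoly a p1 y : ℂ) * u y))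
          + ∫ y, (χ (ε * y) : ℂ) * ((gaussPoly a p2 y : ℂ) * u y) := by
      rw [← integral_const_mul, ← integral_const_mul, ← integral_add, ← integral_add]
      · refine integral_congr_ae (Eventually.of_forall fun y => ?_)
        simp only [hd2]
        push_cast
        ring
      · exact ((hib hχ2 hK2 ε p u).const_mul _).add ((hib hχ1.continuous hK1 ε p1 u).const_mul _)
      · exact hib hχ.continuous hK0 ε p2 u
      · exact (hib hχ2 hK2 ε p u).const_mul _
      · exact (hib hχ1.continuous hK1 ε p1 u).const_mul _
    have e2 : ∫ y, (φ y : ℂ) * ((oscPotential a y : ℂ) * u y)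
        = (∫ y, (χ (ε * y) : ℂ) * ((gaussPoly a (hermiteOp a p) y : ℂ) * u y))
          + ∫ y, (χ (ε * y) : ℂ) * ((gaussPoly a p2 y : ℂ) * u y) := by
      rw [← integral_add (hib hχ.continuous hK0 ε _ u) (hib hχ.continuous hK0 ε p2 u)]
      refine integral_congr_ae (Eventually.of_forall fun y => ?_)
      simp only [← gaussPoly_hermiteOp, oscPotential, φ, p2, p1]
      push_cast
      ring
    have e3 : ∫ y, (φ y : ℂ) * f y = ∫ y, (χ (ε * y) : ℂ) * ((gaussPoly a p y : ℂ) * f y) := by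
      refine integral_congr_ae (Eventually.of_forall fun y => ?_)
      simp only [φ]
      push_cast
      ring
    rw [e1, e2, e3] at hw
    rw [← hw]
    ring
  have ht0 : Tendsto (fun k : ℕ => ((1 / ((k : ℝ) + 1) : ℝ) : ℂ)) atTop (𝓝 0) := by
    have := (Complex.continuous_ofReal.tendsto 0).comp
      (tendsto_one_div_add_atTop_nhds_zero_nat (𝕜 := ℝ))
    rwa [Complex.ofReal_zero] at this
  have hl := ((tendsto_integral_comp_div_mul hχ.continuous hK0 (hi (hermiteOp a p) u)).sub
    ((ht0.const_mul 2).mul (tendsto_integral_comp_div_mul hχ1.continuous hK1 (hi p1 u)))).sub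
    ((ht0.pow 2).mul (tendsto_integral_comp_div_mul hχ2 hK2 (hi p u)))
  have hr := tendsto_integral_comp_div_mul hχ.continuous hK0 (hi p f)
  have := tendsto_nhds_unique (hl.congr fun k => key _ (by positivity)) hr
  simpa [hχ0] using this

end Oscillator

/-! ### The Hermite basis and the oscillator on its maximal domain. -/

section Oscillator

open Polynomial Filter Topology

lemma weakEq_gaussL2_hermitePoly {a : ℝ} (ha : 0 < a) (n : ℕ) :
    WeakEq (oscPotential a) (gaussL2 ha (hermitePoly a n))
      (((n * a : ℝ) : ℂ) • gaussL2 ha (hermitePoly a n)) := by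
  have := weakEq_gaussL2 ha (hermitePoly a n)
  rwa [(hermiteOp_derivative_hermitePoly a n).1, gaussL2_C_mul] at this

/-- A weak solution of `(-∂² + a² y² / 4 - a / 2) u = f` solves the equation coefficientwise. -/
lemma WeakEq.inner_gaussL2_hermitePoly {a : ℝ} (ha : 0 < a) {u f : L2R}
    (h : WeakEq (oscPotential a) u f) (n : ℕ) :
    inner ℂ (gaussL2 ha (hermitePoly a n)) f
      = ((n * a : ℝ) : ℂ) * inner ℂ (gaussL2 ha (hermitePoly a n)) u := by
  rw [inner_gaussL2, ← h.integral_hermiteOp ha, ← inner_gaussL2 ha,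
    (hermiteOp_derivative_hermitePoly a n).1, gaussL2_C_mul, inner_smul_left, Complex.conj_ofReal]

lemma gaussL2_ne_zero {a : ℝ} (ha : 0 < a) {p : ℝ[X]} (hp : p ≠ 0) : gaussL2 ha p ≠ 0 := by
  intro h0
  refine hp (Polynomial.funext fun y => ?_)
  have h1 : (fun y => (gaussPoly a p y : ℂ)) =ᵐ[volume] fun _ => 0 := by
    refine (coeFn_gaussL2 ha p).symm.trans ?_
    rw [h0]
    exact Lp.coeFn_zero ℂ 2 volume
  have h2 := congrFun ((Complex.continuous_ofReal.comp
    (contDiff_gaussPoly a p).continuous).ae_eq_iff_eq volume continuous_const |>.1 h1) y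
  have h3 : gaussPoly a p y = 0 := Complex.ofReal_eq_zero.1 h2
  simpa [gaussPoly, (Real.exp_pos _).ne'] using h3

/-- The normalized Hermite functions form a Hilbert basis. -/
lemma exists_hilbertBasis_hermite {a : ℝ} (ha : 0 < a) :
    ∃ (h : HilbertBasis ℕ ℂ L2R) (c : ℕ → ℝ), ∀ n, c n ≠ 0 ∧
      h n = (c n : ℂ) • gaussL2 ha (hermitePoly a n) := by
  let v : ℕ → L2R := fun n => gaussL2 ha (hermitePoly a n)
  have hv : ∀ n, ‖v n‖ ≠ 0 := fun n =>
    norm_ne_zero_iff.2 (gaussL2_ne_zero ha (hermitePoly_ne_zero ha n))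
  let c : ℕ → ℝ := fun n => ‖v n‖⁻¹
  have hc : ∀ n, c n ≠ 0 := fun n => inv_ne_zero (hv n)
  have horth : Orthonormal ℂ fun n => (c n : ℂ) • v n := by
    refine ⟨fun n => ?_, fun n m hnm => ?_⟩
    · rw [norm_smul, Complex.norm_real, norm_inv, norm_norm, inv_mul_cancel₀ (hv n)]
    -- Orthogonality comes from the distinct eigenvalues `n a ≠ m a`.
    · have := (weakEq_gaussL2_hermitePoly ha m).inner_gaussL2_hermitePoly ha n
      rw [inner_smul_right] at this
      have h0 : inner ℂ (v n) (v m) = 0 := by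
        by_contra hne
        have := mul_right_cancel₀ hne this
        rw [Complex.ofReal_inj] at this
        exact hnm (Nat.cast_injective (mul_right_cancel₀ ha.ne' this)).symm
      simp only [inner_smul_left, inner_smul_right, h0, mul_zero]
  refine ⟨HilbertBasis.mkOfOrthogonalEqBot horth ?_, c, fun n => ⟨hc n, ?_⟩⟩
  · refine (Submodule.eq_bot_iff _).2 fun u hu => eq_zero_of_integral_gaussPoly ha u ?_
    have hn : ∀ n, ∫ y, (gaussPoly a (hermitePoly a n) y : ℂ) * u y = 0 := fun n => by
      have := (Submodule.mem_orthogonal _ _).1 hu _ (Submodule.subset_span ⟨n, rfl⟩)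
      rw [inner_smul_left, Complex.conj_ofReal] at this
      rw [← inner_gaussL2 ha]
      exact (mul_eq_zero.1 this).resolve_left (Complex.ofReal_ne_zero.2 (hc n))
    have hi := fun p => integrable_memLp_mul_L2R (memLp_gaussPoly ha p) u
    let K : Submodule ℝ ℝ[X] :=
      { carrier := {p | ∫ y, (gaussPoly a p y : ℂ) * u y = 0}
        zero_mem' := by simp [gaussPoly]
        add_mem' := fun {p q} hp hq => by
          have : ∫ y, (gaussPoly a (p + q) y : ℂ) * u y
              = (∫ y, (gaussPoly a p y : ℂ) * u y) + ∫ y, (gaussPoly a q y : ℂ) * u y := by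
            rw [← integral_add (hi p) (hi q)]
            refine integral_congr_ae (Eventually.of_forall fun y => ?_)
            simp [gaussPoly, add_mul]
          exact this.trans (by rw [hp, hq, add_zero])
        smul_mem' := fun r p hp => by
          have : ∫ y, (gaussPoly a (r • p) y : ℂ) * u y
              = r * ∫ y, (gaussPoly a p y : ℂ) * u y := by
            rw [← integral_const_mul, smul_eq_C_mul]
            refine integral_congr_ae (Eventually.of_forall fun y => ?_)
            simp [gaussPoly_C_mul, mul_assoc]
          exact this.trans (by rw [hp, mul_zero]) }
    exact hermitePoly_span ha K hn
  · rw [HilbertBasis.coe_mkOfOrthogonalEqBot]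

/-- The harmonic oscillator on its maximal domain is diagonal in the Hermite basis. -/
lemma weakEq_oscPotential_iff {a : ℝ} (ha : 0 < a) {h : HilbertBasis ℕ ℂ L2R} {c : ℕ → ℝ}
    (hh : ∀ n, c n ≠ 0 ∧ h n = (c n : ℂ) • gaussL2 ha (hermitePoly a n)) (u f : L2R) :
    WeakEq (oscPotential a) u f ↔ DiagRel h (fun n => n * a) u f := by
  constructor
  · intro hw n
    rw [(hh n).2, inner_smul_left, inner_smul_left, hw.inner_gaussL2_hermitePoly ha]
    ring
  · refine fun hd => ⟨L2R.locallyIntegrable_mul (continuous_oscPotential a) u, fun φ hφ hc => ?_⟩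
    have hφ2 := continuous_deriv_deriv hφ
    have hm : ∀ {g : ℝ → ℝ}, Continuous g → HasCompactSupport g →
        MemLp (fun y => (g y : ℂ)) 2 := fun hg hgc => (hg.memLp_of_hasCompactSupport hgc).ofReal
    -- `Lφ` is the operator applied to the test function. Its coefficients are `n a` times those of
    -- `φ`, by the weak equation of the Hermite functions tested with `φ`; Parseval's identity then
    -- yields the weak equation for `u`.
    let Lφ : ℝ → ℝ := fun y => -deriv (deriv φ) y + φ y * oscPotential a y
    have hLc : Continuous Lφ := hφ2.neg.add (hφ.continuous.mul (continuous_oscPotential a))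
    have hLs : HasCompactSupport Lφ := hc.deriv.deriv.neg.add hc.mul_right
    have hsplit : ∀ w : L2R, inner ℂ ((hm hLc hLs).toLp _) w
        = -(∫ y, ((deriv (deriv φ) y : ℝ) : ℂ) * w y)
          + ∫ y, (φ y : ℂ) * ((oscPotential a y : ℂ) * w y) := fun w => by
      rw [inner_toLp_ofReal, ← integral_neg, ← integral_add]
      · refine integral_congr_ae (Eventually.of_forall fun y => ?_)
        simp only [Lφ]
        push_cast
        ring
      · exact (integrable_test_mul hφ2 hc.deriv.deriv w.locallyIntegrable).neg
      · exact integrable_test_mul hφ.continuous hc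
          (L2R.locallyIntegrable_mul (continuous_oscPotential a) w)
    rw [← hsplit, ← inner_toLp_ofReal (hm hφ.continuous hc), ← h.tsum_inner_mul_inner,
      ← h.tsum_inner_mul_inner _ f]
    refine tsum_congr fun n => ?_
    have h1 : inner ℂ ((hm hLc hLs).toLp _) (h n)
        = ((n * a : ℝ) : ℂ) * inner ℂ ((hm hφ.continuous hc).toLp _) (h n) := by
      rw [(hh n).2, inner_smul_right, inner_smul_right, hsplit,
        (weakEq_gaussL2_hermitePoly ha n).2 φ hφ hc, ← inner_toLp_ofReal (hm hφ.continuous hc),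
        inner_smul_right]
      ring
    rw [h1, hd n]
    ring

end Oscillator

/-! ### Bounded potentials as multiplication operators. -/

section Multiplication

variable {q : ℝ → ℝ} {K : ℝ}

lemma memLp_mul_L2R (hq : Continuous q) (hK : ∀ y, |q y| ≤ K) (u : L2R) :
    MemLp (fun y => (q y : ℂ) * u y) 2 :=
  MemLp.of_le_mul (Lp.memLp u) ((Complex.continuous_ofReal.comp hq).aestronglyMeasurable.mul
    (Lp.aestronglyMeasurable u)) (c := K) (Filter.Eventually.of_forall fun y => by
      rw [norm_mul, Complex.norm_real]
      exact mul_le_mul_of_nonneg_right (hK y) (norm_nonneg _))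

/-- Multiplication by a bounded continuous function, as a bounded operator in `L²`. -/
noncomputable def mulOp (hq : Continuous q) (hK : ∀ y, |q y| ≤ K) : L2R →L[ℂ] L2R :=
  LinearMap.mkContinuous
    { toFun := fun u => (memLp_mul_L2R hq hK u).toLp _
      map_add' := fun u v => by
        refine Lp.ext ?_
        filter_upwards [(memLp_mul_L2R hq hK (u + v)).coeFn_toLp,
          (memLp_mul_L2R hq hK u).coeFn_toLp,
          (memLp_mul_L2R hq hK v).coeFn_toLp, Lp.coeFn_add u v, Lp.coeFn_add
            ((memLp_mul_L2R hq hK u).toLp _) ((memLp_mul_L2R hq hK v).toLp _)] with y h1 h2 h3 h4 h5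
        rw [h1, h5, Pi.add_apply, h2, h3, h4, Pi.add_apply]
        ring
      map_smul' := fun z u => by
        refine Lp.ext ?_
        filter_upwards [(memLp_mul_L2R hq hK (z • u)).coeFn_toLp,
          (memLp_mul_L2R hq hK u).coeFn_toLp,
          Lp.coeFn_smul z u, Lp.coeFn_smul z ((memLp_mul_L2R hq hK u).toLp _)] with y h1 h2 h3 h4
        rw [h1, RingHom.id_apply, h4, Pi.smul_apply, h2, h3, Pi.smul_apply]
        simp only [smul_eq_mul]
        ring } K
    fun u => Lp.norm_le_mul_norm_of_ae_le_mul <| by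
      filter_upwards [(memLp_mul_L2R hq hK u).coeFn_toLp] with y hy
      change ‖(memLp_mul_L2R hq hK u).toLp _ y‖ ≤ _
      rw [hy, norm_mul, Complex.norm_real]
      exact mul_le_mul_of_nonneg_right (hK y) (norm_nonneg _)

lemma coeFn_mulOp (hq : Continuous q) (hK : ∀ y, |q y| ≤ K) (u : L2R) :
    mulOp hq hK u =ᵐ[volume] fun y => (q y : ℂ) * u y :=
  (memLp_mul_L2R hq hK u).coeFn_toLp

lemma inner_mulOp_left (hq : Continuous q) (hK : ∀ y, |q y| ≤ K) (u v : L2R) :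
    inner ℂ (mulOp hq hK u) v = inner ℂ u (mulOp hq hK v) := by
  rw [L2.inner_def, L2.inner_def]
  refine integral_congr_ae ?_
  filter_upwards [coeFn_mulOp hq hK u, coeFn_mulOp hq hK v] with y h1 h2
  simp only [h1, h2, RCLike.inner_apply, map_mul, Complex.conj_ofReal]
  ring

lemma L2R.norm_sq_eq_integral (u : L2R) : ‖u‖ ^ 2 = ∫ y, ‖u y‖ ^ 2 := by
  have h1 := congrArg Complex.re (L2.inner_def (𝕜 := ℂ) u u)
  rw [← RCLike.re_eq_complex_re, inner_self_eq_norm_sq (𝕜 := ℂ)] at h1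
  rw [h1, ← integral_re (L2.integrable_inner u u)]
  simp only [inner_self_eq_norm_sq (𝕜 := ℂ)]

lemma re_inner_mulOp (hq : Continuous q) (hK : ∀ y, |q y| ≤ K) (u : L2R) :
    (inner ℂ u (mulOp hq hK u)).re = ∫ y, q y * ‖u y‖ ^ 2 := by
  rw [L2.inner_def, ← RCLike.re_eq_complex_re, ← integral_re (L2.integrable_inner u _)]
  refine integral_congr_ae ?_
  filter_upwards [coeFn_mulOp hq hK u] with y hy
  rw [hy, RCLike.inner_apply, mul_assoc, Complex.mul_conj, Complex.normSq_eq_norm_sq,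
    ← Complex.ofReal_mul]
  exact Complex.ofReal_re _

lemma integrable_mul_norm_sq (hq : Continuous q) (hK : ∀ y, |q y| ≤ K) (u : L2R) :
    Integrable fun y => q y * ‖u y‖ ^ 2 :=
  ((Lp.memLp u).integrable_norm_pow two_ne_zero).bdd_mul (c := K) hq.aestronglyMeasurable
    (Filter.Eventually.of_forall hK)

lemma le_re_inner_mulOp (hq : Continuous q) (hK : ∀ y, |q y| ≤ K) {m : ℝ} (hm : ∀ y, m ≤ q y)
    (u : L2R) : m * ‖u‖ ^ 2 ≤ (inner ℂ u (mulOp hq hK u)).re := by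
  rw [re_inner_mulOp, L2R.norm_sq_eq_integral, ← integral_const_mul]
  exact integral_mono (((Lp.memLp u).integrable_norm_pow two_ne_zero).const_mul m)
    (integrable_mul_norm_sq hq hK u) fun y => mul_le_mul_of_nonneg_right (hm y) (by positivity)

lemma re_inner_mulOp_le (hq : Continuous q) (hK : ∀ y, |q y| ≤ K) {M : ℝ} (hM : ∀ y, q y ≤ M)
    (u : L2R) : (inner ℂ u (mulOp hq hK u)).re ≤ M * ‖u‖ ^ 2 := by
  rw [re_inner_mulOp, L2R.norm_sq_eq_integral, ← integral_const_mul]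
  exact integral_mono (integrable_mul_norm_sq hq hK u)
    (((Lp.memLp u).integrable_norm_pow two_ne_zero).const_mul M)
    fun y => mul_le_mul_of_nonneg_right (hM y) (by positivity)

/-- A bounded part of the potential may be moved to the right-hand side. -/
lemma weakEq_add_iff {V : ℝ → ℝ} (hV : Continuous V) (hq : Continuous q) (hK : ∀ y, |q y| ≤ K)
    (u f : L2R) :
    WeakEq (fun y => V y + q y) u f ↔ WeakEq V u (f - mulOp hq hK u) := by
  have h1 := L2R.locallyIntegrable_mul (hV.add hq) u
  have h2 := L2R.locallyIntegrable_mul hV u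
  refine (and_iff_right h1).trans (Iff.trans ?_ (and_iff_right h2).symm)
  refine forall_congr' fun φ => imp_congr_right fun hφ => imp_congr_right fun hc => ?_
  have e1 : ∫ y, (φ y : ℂ) * (((V y + q y : ℝ) : ℂ) * u y)
      = (∫ y, (φ y : ℂ) * ((V y : ℂ) * u y)) + ∫ y, (φ y : ℂ) * mulOp hq hK u y := by
    rw [← integral_add (integrable_test_mul hφ.continuous hc h2)
      (integrable_test_mul hφ.continuous hc (mulOp hq hK u).locallyIntegrable)]
    refine integral_congr_ae ?_
    filter_upwards [coeFn_mulOp hq hK u] with y hy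
    rw [hy]
    push_cast
    ring
  have e2 : ∫ y, (φ y : ℂ) * (f - mulOp hq hK u : L2R) y
      = (∫ y, (φ y : ℂ) * f y) - ∫ y, (φ y : ℂ) * mulOp hq hK u y := by
    rw [← integral_sub (integrable_test_mul hφ.continuous hc f.locallyIntegrable)
      (integrable_test_mul hφ.continuous hc (mulOp hq hK u).locallyIntegrable)]
    refine integral_congr_ae ?_
    filter_upwards [Lp.coeFn_sub f (mulOp hq hK u)] with y hy
    rw [hy, Pi.sub_apply, mul_sub]
  rw [e1, e2, ← add_assoc, eq_sub_iff_add_eq]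

end Multiplication

/-! ### The perturbed oscillator and the theorem. -/

/-- Eigenvalues of a harmonic oscillator perturbed by a bounded continuous potential. -/
theorem eigenvalueSequence_oscPotential_add {a : ℝ} (ha : 0 < a) {q : ℝ → ℝ} (hq : Continuous q)
    {m M : ℝ} (hm : ∀ y, m ≤ q y) (hM : ∀ y, q y ≤ M) :
    (∃ lam, IsEigenvalueSequence (schrodingerOp fun y => oscPotential a y + q y) lam) ∧
      ∀ lam, IsEigenvalueSequence (schrodingerOp fun y => oscPotential a y + q y) lam →
        ∀ n : ℕ, n * a + m ≤ lam n ∧ lam n ≤ n * a + M := by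
  obtain ⟨h, c, hh⟩ := exists_hilbertBasis_hermite ha
  have hK : ∀ y, |q y| ≤ max |m| |M| := fun y => abs_le_max_abs_abs (hm y) (hM y)
  refine eigenvalueSequence_of_perturbation h (d := fun n => n * a) (by simp)
    (fun i j hij => mul_le_mul_of_nonneg_right (Nat.cast_le.2 hij) ha.le)
    (tendsto_natCast_atTop_atTop.atTop_mul_const ha) (mulOp hq hK) (inner_mulOp_left hq hK)
    (le_re_inner_mulOp hq hK hm) (re_inner_mulOp_le hq hK hM) fun u f => ?_
  rw [mem_graph_schrodingerOp, weakEq_add_iff (continuous_oscPotential a) hq hK,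
    weakEq_oscPotential_iff ha hh]

theorem propositionC1 (p a b c : ℝ) (hp : 1 < p) (ha : 0 < a) (hb : 0 ≤ b) (hc : 0 ≤ c) :
    (∃ lam : ℕ → ℝ, IsEigenvalueSequence (linearizedOp p a b c) lam) ∧
      ∀ lam : ℕ → ℝ, IsEigenvalueSequence (linearizedOp p a b c) lam →
        ∀ n : ℕ, (n : ℝ) * a + 2 / (p - 1) * (a - p * c) ≤ lam n ∧
          lam n ≤ (n : ℝ) * a + 2 * a / (p - 1) := by
  have hp1 : 0 < p - 1 := sub_pos.2 hp
  have hden : ∀ y : ℝ, p - 1 ≤ p - 1 + b * y ^ 2 := fun y => le_add_of_nonneg_right (by positivity)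
  have hden0 : ∀ y : ℝ, 0 < p - 1 + b * y ^ 2 := fun y => hp1.trans_le (hden y)
  have hpc : 0 ≤ 2 * p * c := by positivity
  -- The constant `2 a / (p - 1)` joins the bounded part, so that the unperturbed eigenvalues are
  -- exactly `n a`.
  have hV : potentialABC p a b c = fun y => oscPotential a y
      + (2 * a / (p - 1) - 2 * p * c / (p - 1 + b * y ^ 2)) := by
    ext y
    simp only [potentialABC, oscPotential]
    ring
  have hmid : 2 / (p - 1) * (a - p * c) = 2 * a / (p - 1) - 2 * p * c / (p - 1) := by ring
  rw [linearizedOp, hV, hmid]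
  refine eigenvalueSequence_oscPotential_add ha ?_ (fun y => ?_) fun y => ?_
  · exact continuous_const.sub (continuous_const.div (by fun_prop) fun y => (hden0 y).ne')
  · exact sub_le_sub_left (div_le_div_of_nonneg_left hpc hp1 (hden y)) _
  · exact sub_le_self _ (div_nonneg hpc (hden0 y).le)
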